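/- Let $d\in\{2,3\}$ and let $\Omega\subset\mathbb{R}^d$ be a bounded, polygonal (polyhedral) Lipschitz domain. Let $1\le\beta<\infty$, and let $W^\beta(\operatorname{div};\Omega)$ be the space of all vector fields $p\in L^\beta(\Omega;\mathbb{R}^d)$ for which there is a function $f=:\operatorname{div}p\in L^\beta(\Omega)$ with $\int_\Omega p\cdot\nabla\varphi\,dx=-\int_\Omega f\varphi\,dx$ for all $\varphi\in C_c^1(\Omega)$, with the norm $\|p\|_{W^\beta(\operatorname{div};\Omega)}=\|p\|_{L^\beta(\Omega)}+\|\operatorname{div}p\|_{L^\beta(\Omega)}$. Let $(\mathcal{T}_h)_{h>0}$ be a regular family of triangulations of $\Omega$, that is: each $\mathcal{T}_h$ is a finite conforming decomposition of $\overline\Omega$ into nondegenerate closed $d$-simplices, every $T\in\mathcal{T}_h$ has diameter $\operatorname{diam}(T)\le h$, and there is $\kappa>0$ such that for all $h>0$ every $T\in\mathcal{T}_h$ contains a ball of radius $\kappa\operatorname{diam}(T)$. Let $\mathcal{S}^1(\mathcal{T}_h)^d$ be the space of all $q\in C(\overline\Omega;\mathbb{R}^d)$ whose restriction to each $T\in\mathcal{T}_h$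 is affine. Then for every $p\in W^\beta(\operatorname{div};\Omega)$ and every $\varepsilon>0$ there exists $h(\varepsilon)>0$ such that for all $0<h\le h(\varepsilon)$ there exists $q_h\in\mathcal{S}^1(\mathcal{T}_h)^d\subset W^\beta(\operatorname{div};\Omega)$ with $$\|p-q_h\|_{W^\beta(\operatorname{div};\Omega)}<\varepsilon.$$ -/

import Mathlib

open MeasureTheory
open scoped ENNReal NNReal

namespace DivFE

/-- Euclidean space of dimension `d`, with the Euclidean norm. -/
abbrev Space (d : ℕ) : Type := EuclideanSpace ℝ (Fin d)

/-! ### Domains -/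

/-- The boundary of `Ω` is locally the graph of a Lipschitz function, with `Ω` on one side of it:
around each boundary point there are a direction `e` (the vertical axis) and a Lipschitz
function `γ` on the hyperplane orthogonal to `e` such that, near the point, `Ω` is the set of
points lying strictly above the graph of `γ`. -/
def HasLipschitzBoundary {d : ℕ} (Ω : Set (Space d)) : Prop :=
  ∀ x ∈ frontier Ω, ∃ r : ℝ, 0 < r ∧ ∃ e : Space d, ‖e‖ = 1 ∧
    ∃ (L : ℝ≥0) (γ : (Submodule.span ℝ {e})ᗮ → ℝ), LipschitzWith L γ ∧
      ∀ y ∈ Metric.ball x r,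
        (y ∈ Ω ↔ γ ((Submodule.span ℝ {e})ᗮ.orthogonalProjectionOnto y) < inner ℝ e y)

/-- The closure of `Ω` is a finite union of nondegenerate closed `d`-simplices. -/
def IsPolyhedral {d : ℕ} (Ω : Set (Space d)) : Prop :=
  ∃ F : Finset (Finset (Space d)),
    (∀ s ∈ F, s.card = d + 1 ∧ AffineIndependent ℝ ((↑) : s → Space d)) ∧
      closure Ω = ⋃ s ∈ F, convexHull ℝ (s : Set (Space d))

/-- Bounded, polygonal (polyhedral) Lipschitz domains. -/
structure IsPolyhedralLipschitzDomain {d : ℕ} (Ω : Set (Space d)) : Prop where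
  isOpen : IsOpen Ω
  isConnected : IsConnected Ω
  isBounded : Bornology.IsBounded Ω
  isPolyhedral : IsPolyhedral Ω
  hasLipschitzBoundary : HasLipschitzBoundary Ω

/-! ### The space `W^β(div; Ω)` -/

/-- `f` is the weak divergence of `p` in `Ω`:
`∫_Ω p · ∇φ = - ∫_Ω f φ` for all `φ ∈ C_c^1(Ω)`. -/
def IsWeakDiv {d : ℕ} (Ω : Set (Space d)) (p : Space d → Space d) (f : Space d → ℝ) : Prop :=
  ∀ φ : Space d → ℝ, ContDiff ℝ 1 φ → HasCompactSupport φ → tsupport φ ⊆ Ω →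
    ∫ x in Ω, inner ℝ (p x) (gradient φ x) = -∫ x in Ω, f x * φ x

/-- `p` has a weak divergence that belongs to `L^β(Ω)`. -/
def HasWeakDivInLp {d : ℕ} (β : ℝ≥0∞) (Ω : Set (Space d)) (p : Space d → Space d) : Prop :=
  ∃ f : Space d → ℝ, MemLp f β (volume.restrict Ω) ∧ IsWeakDiv Ω p f

/-- Membership in `W^β(div; Ω)`. -/
def MemWDiv {d : ℕ} (β : ℝ≥0∞) (Ω : Set (Space d)) (p : Space d → Space d) : Prop :=
  MemLp p β (volume.restrict Ω) ∧ HasWeakDivInLp β Ω p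

open Classical in
/-- The weak divergence in `L^β(Ω)` of a field that has one; it is unique up to null sets by
`IsWeakDiv.ae_eq`. -/
noncomputable def weakDiv {d : ℕ} (β : ℝ≥0∞) (Ω : Set (Space d)) (p : Space d → Space d) :
    Space d → ℝ :=
  if h : HasWeakDivInLp β Ω p then h.choose else 0

/-- The norm `‖p‖_{L^β(Ω)} + ‖div p‖_{L^β(Ω)}` of `W^β(div; Ω)`, to be used on fields `p` with
`MemWDiv β Ω p`. -/
noncomputable def wDivNorm {d : ℕ} (β : ℝ≥0∞) (Ω : Set (Space d)) (p : Space d → Space d) :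
    ℝ≥0∞ :=
  eLpNorm p β (volume.restrict Ω) + eLpNorm (weakDiv β Ω p) β (volume.restrict Ω)

theorem weakDiv_spec {d : ℕ} {β : ℝ≥0∞} {Ω : Set (Space d)} {p : Space d → Space d}
    (h : HasWeakDivInLp β Ω p) :
    MemLp (weakDiv β Ω p) β (volume.restrict Ω) ∧ IsWeakDiv Ω p (weakDiv β Ω p) := by
  unfold weakDiv
  rw [dif_pos h]
  exact h.choose_spec

/-- Weak divergences in `L^β(Ω)` are unique up to null sets. -/
theorem IsWeakDiv.ae_eq {d : ℕ} {β : ℝ≥0∞} (hβ : 1 ≤ β) {Ω : Set (Space d)} (hΩ : IsOpen Ω)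
    {p : Space d → Space d} {f g : Space d → ℝ}
    (hf : MemLp f β (volume.restrict Ω)) (hg : MemLp g β (volume.restrict Ω))
    (hpf : IsWeakDiv Ω p f) (hpg : IsWeakDiv Ω p g) : f =ᵐ[volume.restrict Ω] g := by
  have hfl : LocallyIntegrable f (volume.restrict Ω) := hf.locallyIntegrable hβ
  have hgl : LocallyIntegrable g (volume.restrict Ω) := hg.locallyIntegrable hβ
  have key : ∀ᵐ x ∂volume, x ∈ Ω → (f - g) x = 0 := by
    refine hΩ.ae_eq_zero_of_integral_contDiff_smul_eq_zero ?_ ?_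
    · rw [locallyIntegrableOn_iff hΩ.isLocallyClosed]
      intro k hk hkc
      have := (hfl.sub hgl).integrableOn_isCompact hkc
      rwa [IntegrableOn, Measure.restrict_restrict_of_subset hk] at this
    · intro φ hφ hc hs
      have h1 : ContDiff ℝ 1 φ := hφ.of_le (by exact_mod_cast le_top)
      have hfφ : Integrable (fun x => f x * φ x) (volume.restrict Ω) := by
        simpa [mul_comm] using hfl.integrable_smul_left_of_hasCompactSupport hφ.continuous hc
      have hgφ : Integrable (fun x => g x * φ x) (volume.restrict Ω) := by
        simpa [mul_comm] using hgl.integrable_smul_left_of_hasCompactSupport hφ.continuous hc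
      have e : ∫ x in Ω, f x * φ x = ∫ x in Ω, g x * φ x := by
        have := (hpf φ h1 hc hs).symm.trans (hpg φ h1 hc hs)
        linarith
      rw [← setIntegral_eq_integral_of_forall_compl_eq_zero (s := Ω)]
      · have : ∀ x, φ x • (f - g) x = f x * φ x - g x * φ x := fun x => by
          simp only [Pi.sub_apply, smul_eq_mul]; ring
        simp only [this]
        rw [integral_sub hfφ hgφ, e, sub_self]
      · intro x hx
        rw [image_eq_zero_of_notMem_tsupport (fun h => hx (hs h)), zero_smul]
  rw [Filter.EventuallyEq, ae_restrict_iff' hΩ.measurableSet]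
  filter_upwards [key] with x hx h
  exact sub_eq_zero.1 (hx h)

/-! ### Triangulations and finite elements -/

/-- The (closed) elements of a triangulation are its `d`-dimensional simplices; they are
represented by their vertex sets. -/
def elements {d : ℕ} (K : Geometry.SimplicialComplex ℝ (Space d)) : Set (Finset (Space d)) :=
  {s | s ∈ K.faces ∧ s.card = d + 1}

/-- `K` is a (conforming) triangulation of `Ω`: a finite simplicial complex consisting of
`d`-simplices and their faces whose union is the closure of `Ω`. -/
structure IsTriangulation {d : ℕ} (K : Geometry.SimplicialComplex ℝ (Space d))
    (Ω : Set (Space d)) : Prop where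
  finite : K.faces.Finite
  pure : ∀ s ∈ K.faces, ∃ t ∈ elements K, s ⊆ t
  space_eq : K.space = closure Ω

/-- `(T h)` for `h > 0` is a regular family of triangulations of `Ω`: every `T h` is a conforming
triangulation all of whose elements have diameter at most `h`, and the family is shape regular,
i.e. every element `S` contains a ball of radius at least `κ * diam S`, where `κ > 0` does not
depend on `h` or `S`. -/
structure IsRegularFamily {d : ℕ} (T : ℝ → Geometry.SimplicialComplex ℝ (Space d))
    (Ω : Set (Space d)) : Prop where
  isTriangulation : ∀ h : ℝ, 0 < h → IsTriangulation (T h) Ω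
  diam_le : ∀ h : ℝ, 0 < h → ∀ s ∈ elements (T h),
    Metric.diam (convexHull ℝ (s : Set (Space d))) ≤ h
  shapeRegular : ∃ κ : ℝ, 0 < κ ∧ ∀ h : ℝ, 0 < h → ∀ s ∈ elements (T h), ∃ c : Space d,
    Metric.closedBall c (κ * Metric.diam (convexHull ℝ (s : Set (Space d)))) ⊆
      convexHull ℝ (s : Set (Space d))

/-- `q` belongs to `S^1(K)^d`: it is continuous on the closure of `Ω` and agrees with an affine
map on every element of `K`. -/
def MemS1 {d : ℕ} (K : Geometry.SimplicialComplex ℝ (Space d)) (Ω : Set (Space d))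
    (q : Space d → Space d) : Prop :=
  ContinuousOn q (closure Ω) ∧
    ∀ s ∈ elements K, ∃ A : Space d →ᵃ[ℝ] Space d,
      Set.EqOn q A (convexHull ℝ (s : Set (Space d)))

end DivFE

/-! Smooth fields are dense in W^β(div; Ω), and smooth fields are approximated by their nodal
interpolants.

Density (`exists_contDiff_approx`) is the delicate half: extending p by zero across the boundary may
create a singular divergence there. A partition of unity cuts p into pieces, each supported inside Ω
or near a boundary patch where Ω lies above a Lipschitz graph. Each piece v, extended by zero, is
mollified with an off-centre kernel ρ, so that the value at x ∈ Ω uses only values of v in a small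
ball pushed from x into Ω. Then y ↦ ρ(x - y) is an admissible test function, which gives div(ρ ⋆ v)
= ρ ⋆ div v at every point of Ω, and both convolutions converge in L^β. The terms v · ∇φ_i from the
cutoffs cancel in the sum, because ∑ φ_i = 1 on Ω.

For a C² field u whose derivative has Lipschitz constant M, a Taylor expansion on an element of
diameter D containing a ball of radius κD bounds the interpolation error by M D² and that of the
derivative by 2MD/κ (`norm_sub_interpolant_le`). Both tend to zero uniformly, hence in L^β on the
bounded set Ω. Finally, a piecewise affine continuous field is locally Lipschitz in Ω, so its a.e.
divergence is its weak divergence (`MemS1.isWeakDiv`) and the two errors add up to the norm. -/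

namespace DivFE

open scoped Convolution
open ContinuousLinearMap (lsmul)

/-! ### Mollification in L^p with kernels that need not be symmetric -/

section Convolution

variable {d : ℕ} {F : Type*} [NormedAddCommGroup F] [NormedSpace ℝ F]

/-- Averaging translates of `w` against a probability density does not increase the `L^p` norm. -/
theorem eLpNorm_convolution_le {p : ℝ≥0∞} (hp : 1 ≤ p) (hp' : p ≠ ∞) {ρ : Space d → ℝ}
    (hρ : Continuous ρ) (hρ0 : ∀ x, 0 ≤ ρ x) (hρ1 : ∫ x, ρ x = 1)
    {w : Space d → F} (hw : AEStronglyMeasurable w volume) :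
    eLpNorm (ρ ⋆[lsmul ℝ ℝ, volume] w) p volume ≤ eLpNorm w p volume := by
  have hp0 : p ≠ 0 := (zero_lt_one.trans_le hp).ne'
  have hpr : 0 < p.toReal := ENNReal.toReal_pos hp0 hp'
  set δ : Space d → ℝ≥0∞ := fun x => ENNReal.ofReal (ρ x) with hδ
  have hδm : Measurable δ := hρ.measurable.ennreal_ofReal
  have hδ1 : ∫⁻ x, δ x = 1 := by
    rw [← ofReal_integral_eq_lintegral_ofReal (integrable_of_integral_eq_one hρ1)
      (Filter.Eventually.of_forall hρ0), hρ1, ENNReal.ofReal_one]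
  have hprob : IsProbabilityMeasure (volume.withDensity δ) :=
    ⟨by rw [withDensity_apply _ MeasurableSet.univ, setLIntegral_univ, hδ1]⟩
  have hsub : ∀ x : Space d, MeasurePreserving (fun z => x - z) volume volume := fun x =>
    Measure.measurePreserving_sub_left volume x
  -- Jensen's inequality, in the form that the L^1 norm is at most the L^p norm for the probability
  -- measure ρ dz. Tonelli and translation invariance then conclude.
  have pointwise : ∀ x, ‖(ρ ⋆[lsmul ℝ ℝ, volume] w) x‖ₑ ^ p.toReal
      ≤ ∫⁻ z, δ z * ‖w (x - z)‖ₑ ^ p.toReal := by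
    intro x
    have hwx : AEStronglyMeasurable (fun z => w (x - z)) volume :=
      hw.comp_measurePreserving (hsub x)
    have hwx' : AEStronglyMeasurable (fun z => w (x - z)) (volume.withDensity δ) :=
      hwx.mono_ac (withDensity_absolutelyContinuous _ _)
    have h1 : ‖(ρ ⋆[lsmul ℝ ℝ, volume] w) x‖ₑ
        ≤ eLpNorm (fun z => w (x - z)) 1 (volume.withDensity δ) := by
      rw [eLpNorm_one_eq_lintegral_enorm,
        lintegral_withDensity_eq_lintegral_mul₀ hδm.aemeasurable hwx.enorm]
      refine (enorm_integral_le_lintegral_enorm _).trans (le_of_eq ?_)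
      refine lintegral_congr fun z => ?_
      simp only [ContinuousLinearMap.lsmul_apply, enorm_smul, Pi.mul_apply, hδ]
      rw [Real.enorm_of_nonneg (hρ0 z)]
    have h2 := h1.trans (eLpNorm_le_eLpNorm_of_exponent_le hp hwx')
    rw [eLpNorm_eq_lintegral_rpow_enorm_toReal hp0 hp',
      lintegral_withDensity_eq_lintegral_mul₀ hδm.aemeasurable (hwx.enorm.pow_const _)] at h2
    calc _ ≤ _ := ENNReal.rpow_le_rpow h2 hpr.le
      _ = _ := by
        rw [← ENNReal.rpow_mul, one_div, inv_mul_cancel₀ hpr.ne', ENNReal.rpow_one]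
        rfl
  rw [eLpNorm_eq_lintegral_rpow_enorm_toReal hp0 hp', eLpNorm_eq_lintegral_rpow_enorm_toReal hp0 hp']
  refine ENNReal.rpow_le_rpow ?_ (by positivity)
  have hG : AEMeasurable (fun y => ‖w y‖ₑ ^ p.toReal) volume := hw.enorm.pow_const _
  calc ∫⁻ x, ‖(ρ ⋆[lsmul ℝ ℝ, volume] w) x‖ₑ ^ p.toReal
      ≤ ∫⁻ x, ∫⁻ z, δ z * ‖w (x - z)‖ₑ ^ p.toReal := lintegral_mono pointwise
    _ = ∫⁻ z, ∫⁻ x, δ z * ‖w (x - z)‖ₑ ^ p.toReal := by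
      refine lintegral_lintegral_swap ?_
      have hq : Measure.QuasiMeasurePreserving (fun q : Space d × Space d => q.1 - q.2)
          (volume.prod volume) volume := by
        simpa using quasiMeasurePreserving_sub volume volume
      exact (hδm.comp measurable_snd).aemeasurable.mul (hG.comp_quasiMeasurePreserving hq)
    _ = ∫⁻ z, δ z * ∫⁻ x, ‖w x‖ₑ ^ p.toReal := by
      refine lintegral_congr fun z => ?_
      rw [lintegral_const_mul' _ _ ENNReal.ofReal_ne_top]
      congr 1
      exact lintegral_sub_right_eq_self (fun y => ‖w y‖ₑ ^ p.toReal) z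
    _ = ∫⁻ x, ‖w x‖ₑ ^ p.toReal := by
      rw [lintegral_mul_const _ hδm, hδ1, one_mul]

/-- Convolution with probability densities supported close to the origin approximates `L^p`
functions. The densities need not be symmetric. -/
theorem exists_eLpNorm_convolution_sub_le [CompleteSpace F] {p : ℝ≥0∞} (hp : 1 ≤ p) (hp' : p ≠ ∞)
    {w : Space d → F} (hw : MemLp w p volume) {ε : ℝ≥0∞} (hε : ε ≠ 0) :
    ∃ r : ℝ, 0 < r ∧ ∀ ρ : Space d → ℝ, Continuous ρ → HasCompactSupport ρ → (∀ x, 0 ≤ ρ x) →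
      ∫ x, ρ x = 1 → Function.support ρ ⊆ Metric.ball 0 r →
        eLpNorm ((ρ ⋆[lsmul ℝ ℝ, volume] w) - w) p volume ≤ ε := by
  have h3 : ε / 3 ≠ 0 := (ENNReal.div_pos hε (by norm_num)).ne'
  obtain ⟨c, hcs, hcw, hcc, hcL⟩ := hw.exists_hasCompactSupport_eLpNorm_sub_le hp' h3
  -- For kernels supported in the unit ball, ρ ⋆ c - c vanishes off S. A uniform bound η therefore
  -- costs only η |S|^(1/p) in L^p.
  set S : Set (Space d) := Metric.cthickening 1 (tsupport c) with hS
  have hSc : IsCompact S := hcs.isCompact.cthickening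
  obtain ⟨η, hη, hηε⟩ : ∃ η : ℝ, 0 < η ∧ ENNReal.ofReal η * volume S ^ (1 / p.toReal) ≤ ε / 3 := by
    have hT : volume S ^ (1 / p.toReal) ≠ ∞ :=
      ENNReal.rpow_ne_top_of_nonneg (by positivity) hSc.measure_lt_top.ne
    obtain ⟨a, ha, haε⟩ := ENNReal.exists_nnreal_pos_mul_lt hT h3
    exact ⟨a, ha, by simpa using haε.le⟩
  obtain ⟨r, hr, hrc⟩ := Metric.uniformContinuous_iff.1
    (hcs.uniformContinuous_of_continuous hcc) η hη
  refine ⟨min r 1, by positivity, fun ρ hρ hρs hρ0 hρ1 hρr => ?_⟩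
  have hpt : ∀ x, ‖((ρ ⋆[lsmul ℝ ℝ, volume] c) - c) x‖ ≤ S.indicator (fun _ => η) x := by
    intro x
    rw [Pi.sub_apply, ← dist_eq_norm]
    by_cases hx : x ∈ S
    · rw [Set.indicator_of_mem hx]
      refine dist_convolution_le hη.le (hρr.trans (Metric.ball_subset_ball (min_le_left r 1))) hρ0
        hρ1 hcc.aestronglyMeasurable fun y hy => (hrc hy).le
    · rw [Set.indicator_of_notMem hx]
      have hz : ∀ y ∈ Metric.closedBall x 1, c y = 0 := by
        intro y hy
        refine image_eq_zero_of_notMem_tsupport fun h => hx ?_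
        exact Metric.mem_cthickening_of_dist_le x y 1 _ h (by rwa [dist_comm])
      refine dist_convolution_le le_rfl (hρr.trans (Metric.ball_subset_ball (min_le_right r 1))) hρ0
        hρ1 hcc.aestronglyMeasurable fun y hy => ?_
      rw [hz y (Metric.ball_subset_closedBall hy), hz x (by simp), dist_self]
  have hc3 : eLpNorm ((ρ ⋆[lsmul ℝ ℝ, volume] c) - c) p volume ≤ ε / 3 := by
    refine (eLpNorm_mono_real hpt).trans ?_
    rw [eLpNorm_indicator_const hSc.measurableSet (zero_lt_one.trans_le hp).ne' hp',
      Real.enorm_of_nonneg hη.le]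
    exact hηε
  have hwl := hw.locallyIntegrable hp
  have hcl := hcL.locallyIntegrable hp
  have hsplit : (ρ ⋆[lsmul ℝ ℝ, volume] w) - w
      = (ρ ⋆[lsmul ℝ ℝ, volume] (w - c)) + ((ρ ⋆[lsmul ℝ ℝ, volume] c) - c) - (w - c) := by
    have h := ConvolutionExists.distrib_add (L := lsmul ℝ ℝ) (μ := volume)
      (hρs.convolutionExists_left (lsmul ℝ ℝ) hρ (hwl.sub hcl))
      (hρs.convolutionExists_left (lsmul ℝ ℝ) hρ hcl)
    rw [sub_add_cancel] at h
    rw [h]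
    abel
  have hcm : Continuous (ρ ⋆[lsmul ℝ ℝ, volume] c) :=
    hρs.continuous_convolution_left (lsmul ℝ ℝ) hρ hcl
  have hwcm : Continuous (ρ ⋆[lsmul ℝ ℝ, volume] (w - c)) :=
    hρs.continuous_convolution_left (lsmul ℝ ℝ) hρ (hwl.sub hcl)
  have hwc : AEStronglyMeasurable (w - c) volume := (hw.sub hcL).1
  rw [hsplit]
  calc _ ≤ eLpNorm ((ρ ⋆[lsmul ℝ ℝ, volume] (w - c)) + ((ρ ⋆[lsmul ℝ ℝ, volume] c) - c)) p volume
        + eLpNorm (w - c) p volume := eLpNorm_sub_le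
          (hwcm.add (hcm.sub hcc)).aestronglyMeasurable hwc hp
    _ ≤ ε / 3 + ε / 3 + ε / 3 := by
      gcongr
      refine (eLpNorm_add_le hwcm.aestronglyMeasurable (hcm.sub hcc).aestronglyMeasurable hp).trans ?_
      gcongr
      exact (eLpNorm_convolution_le hp hp' hρ hρ0 hρ1 hwc).trans hcw
    _ = ε := ENNReal.add_thirds ε

end Convolution

end DivFE

namespace DivFE

/-! ### Calculus of weak divergences -/

section WeakDivergence

variable {d : ℕ}

/-- The sum of the diagonal entries of a linear map. -/
noncomputable def diagSum (A : Space d →L[ℝ] Space d) : ℝ :=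
  ∑ i, A (EuclideanSpace.single i 1) i

theorem diagSum_sub (A B : Space d →L[ℝ] Space d) : diagSum (A - B) = diagSum A - diagSum B := by
  simp [diagSum, Finset.sum_sub_distrib]

theorem abs_diagSum_le (A : Space d →L[ℝ] Space d) : |diagSum A| ≤ d * ‖A‖ := by
  refine (Finset.abs_sum_le_sum_abs _ _).trans ?_
  calc _ ≤ ∑ _i : Fin d, ‖A‖ := Finset.sum_le_sum fun i _ => by
        refine (PiLp.norm_apply_le (A (EuclideanSpace.single i 1)) i).trans ?_
        simpa using A.le_opNorm (EuclideanSpace.single i (1 : ℝ))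
    _ = d * ‖A‖ := by simp

theorem continuous_diagSum : Continuous (diagSum : (Space d →L[ℝ] Space d) → ℝ) := by
  unfold diagSum
  fun_prop

theorem inner_gradient_eq (φ : Space d → ℝ) (x a : Space d) :
    inner ℝ a (gradient φ x) = fderiv ℝ φ x a := by
  rw [real_inner_comm, gradient, InnerProductSpace.toDual_symm_apply]

theorem continuous_gradient {φ : Space d → ℝ} (hφ : ContDiff ℝ 1 φ) : Continuous (gradient φ) :=
  (InnerProductSpace.toDual ℝ (Space d)).symm.continuous.comp (hφ.continuous_fderiv one_ne_zero)

theorem hasCompactSupport_gradient {φ : Space d → ℝ} (hc : HasCompactSupport φ) :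
    HasCompactSupport (gradient φ) :=
  (hc.fderiv ℝ).comp_left (map_zero _)

theorem gradient_mul {φ ψ : Space d → ℝ} (hφ : ContDiff ℝ 1 φ) (hψ : ContDiff ℝ 1 ψ)
    (x : Space d) :
    gradient (fun x => φ x * ψ x) x = φ x • gradient ψ x + ψ x • gradient φ x := by
  unfold gradient
  rw [fderiv_fun_mul (hφ.differentiable one_ne_zero x) (hψ.differentiable one_ne_zero x)]
  simp

variable {μ : Measure (Space d)}

theorem integrable_inner_of_hasCompactSupport {p G : Space d → Space d} (hp : Integrable p μ)
    (hG : Continuous G) (hc : HasCompactSupport G) :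
    Integrable (fun x => inner ℝ (p x) (G x)) μ := by
  obtain ⟨C, hC⟩ := hc.exists_bound_of_continuous hG
  refine (hp.norm.mul_const C).mono' (hp.1.inner hG.aestronglyMeasurable)
    (Filter.Eventually.of_forall fun x => ?_)
  exact (norm_inner_le_norm _ _).trans (by gcongr; exact hC x)

theorem integrable_mul_of_hasCompactSupport {f φ : Space d → ℝ} (hf : Integrable f μ)
    (hφ : Continuous φ) (hc : HasCompactSupport φ) : Integrable (fun x => f x * φ x) μ := by
  obtain ⟨C, hC⟩ := hc.exists_bound_of_continuous hφ
  refine (hf.norm.mul_const C).mono' (hf.1.mul hφ.aestronglyMeasurable)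
    (Filter.Eventually.of_forall fun x => ?_)
  rw [norm_mul]
  gcongr
  exact hC x

variable {Ω : Set (Space d)}

theorem IsWeakDiv.sub {p q : Space d → Space d} {f g : Space d → ℝ}
    (hp : Integrable p (volume.restrict Ω)) (hq : Integrable q (volume.restrict Ω))
    (hf : Integrable f (volume.restrict Ω)) (hg : Integrable g (volume.restrict Ω))
    (hpf : IsWeakDiv Ω p f) (hqg : IsWeakDiv Ω q g) : IsWeakDiv Ω (p - q) (f - g) := by
  intro φ hφ hc hs
  have h1 := continuous_gradient hφ
  have h2 := hasCompactSupport_gradient hc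
  simp only [Pi.sub_apply, inner_sub_left, sub_mul]
  rw [integral_sub (integrable_inner_of_hasCompactSupport hp h1 h2)
      (integrable_inner_of_hasCompactSupport hq h1 h2),
    integral_sub (integrable_mul_of_hasCompactSupport hf hφ.continuous hc)
      (integrable_mul_of_hasCompactSupport hg hφ.continuous hc),
    hpf φ hφ hc hs, hqg φ hφ hc hs]
  ring

/-- The product rule for the weak divergence. -/
theorem IsWeakDiv.smul {p : Space d → Space d} {f : Space d → ℝ}
    (hp : Integrable p (volume.restrict Ω)) (hf : Integrable f (volume.restrict Ω))
    (hpf : IsWeakDiv Ω p f) {η : Space d → ℝ} (hη : ContDiff ℝ 1 η) :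
    IsWeakDiv Ω (fun x => η x • p x) (fun x => η x * f x + inner ℝ (p x) (gradient η x)) := by
  intro φ hφ hc hs
  have hcm : HasCompactSupport fun x => η x * φ x := hc.mul_left
  have hsm : tsupport (fun x => η x * φ x) ⊆ Ω :=
    (closure_mono (Function.support_subset_iff'.2 fun x hx => by
      rw [Function.notMem_support.1 hx, mul_zero])).trans hs
  have hφη : HasCompactSupport fun x => φ x • gradient η x := hc.smul_right
  have hηφ : HasCompactSupport fun x => η x • gradient φ x :=
    (hasCompactSupport_gradient hc).mono (Function.support_smul_subset_right η (gradient φ))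
  have hηφd : ContDiff ℝ 1 (fun x => η x * φ x) := hη.mul hφ
  have key := hpf _ hηφd hcm hsm
  have hi1 : Integrable (fun x => inner ℝ (p x) (η x • gradient φ x)) (volume.restrict Ω) :=
    integrable_inner_of_hasCompactSupport hp (hη.continuous.smul (continuous_gradient hφ))
      hηφ
  have hi2 : Integrable (fun x => inner ℝ (p x) (φ x • gradient η x)) (volume.restrict Ω) :=
    integrable_inner_of_hasCompactSupport hp (hφ.continuous.smul (continuous_gradient hη))
      hφη
  have hi3 : Integrable (fun x => f x * (η x * φ x)) (volume.restrict Ω) :=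
    integrable_mul_of_hasCompactSupport hf (hη.continuous.mul hφ.continuous) hcm
  simp only [gradient_mul hη hφ, inner_add_right] at key
  rw [integral_add hi1 hi2] at key
  have e1 : ∀ x, inner ℝ (η x • p x) (gradient φ x) = inner ℝ (p x) (η x • gradient φ x) :=
    fun x => by rw [real_inner_smul_left, real_inner_smul_right]
  have e2 : ∀ x, (η x * f x + inner ℝ (p x) (gradient η x)) * φ x
      = f x * (η x * φ x) + inner ℝ (p x) (φ x • gradient η x) :=
    fun x => by rw [real_inner_smul_right]; ring
  simp only [e1, e2]
  rw [integral_add hi3 hi2]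
  linarith

/-- Weak divergences only depend on the almost everywhere classes in `Ω`. -/
theorem IsWeakDiv.congr {p q : Space d → Space d} {f g : Space d → ℝ} (h : IsWeakDiv Ω p f)
    (hpq : p =ᵐ[volume.restrict Ω] q) (hfg : f =ᵐ[volume.restrict Ω] g) : IsWeakDiv Ω q g := by
  intro φ hφ hc hs
  have h1 : ∫ x in Ω, inner ℝ (p x) (gradient φ x) = ∫ x in Ω, inner ℝ (q x) (gradient φ x) :=
    integral_congr_ae (hpq.mono fun x hx => by simp only [hx])
  have h2 : ∫ x in Ω, f x * φ x = ∫ x in Ω, g x * φ x :=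
    integral_congr_ae (hfg.mono fun x hx => by simp only [hx])
  rw [← h1, ← h2]
  exact h φ hφ hc hs

end WeakDivergence

/-! ### Pointwise divergence of locally Lipschitz fields -/

section Lipschitz

variable {d : ℕ} {Ω : Set (Space d)}

/-- Compactness gives one constant on the 1-neighbourhood of the support. A point of the support and
a point outside that neighbourhood are at distance at least 1, so there the sup bound of F serves as
Lipschitz constant. -/
theorem exists_lipschitzWith_of_locallyLipschitz {F : Space d → Space d}
    (hF : ∀ x, ∃ K : ℝ≥0, ∃ t ∈ nhds x, LipschitzOnWith K F t) (hc : HasCompactSupport F) :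
    ∃ K : ℝ≥0, LipschitzWith K F := by
  have hcont : Continuous F := continuous_iff_continuousAt.2 fun x => by
    obtain ⟨K, t, ht, hK⟩ := hF x
    exact hK.continuousOn.continuousAt ht
  obtain ⟨C, hC⟩ := hc.exists_bound_of_continuous hcont
  have hC0 : 0 ≤ C := (norm_nonneg _).trans (hC 0)
  have hS : IsCompact (Metric.cthickening 1 (tsupport F)) := hc.isCompact.cthickening
  obtain ⟨K, hK⟩ := LocallyLipschitzOn.exists_lipschitzOnWith_of_compact hS (f := F)
    fun x _ => by
      obtain ⟨K, t, ht, hK⟩ := hF x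
      exact ⟨K, t, mem_nhdsWithin_of_mem_nhds ht, hK⟩
  have key : ∀ x y, x ∈ tsupport F → dist (F x) (F y) ≤ max (K : ℝ) C * dist x y := by
    intro x y hx
    have hx' : x ∈ Metric.cthickening 1 (tsupport F) := Metric.self_subset_cthickening _ hx
    by_cases hy : y ∈ Metric.cthickening 1 (tsupport F)
    · exact (hK.dist_le_mul x hx' y hy).trans (by gcongr; exact le_max_left _ _)
    · have h1 : 1 ≤ dist x y := by
        by_contra! h
        exact hy (Metric.mem_cthickening_of_dist_le y x 1 _ hx (by rw [dist_comm]; exact h.le))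
      have hy0 : F y = 0 := image_eq_zero_of_notMem_tsupport fun h =>
        hy (Metric.self_subset_cthickening _ h)
      rw [hy0, dist_zero_right]
      calc ‖F x‖ ≤ C * 1 := by simpa using hC x
        _ ≤ max (K : ℝ) C * dist x y := by gcongr; exact le_max_right _ _
  refine ⟨max K (NNReal.mk C hC0), LipschitzWith.of_dist_le_mul fun x y => ?_⟩
  rw [NNReal.coe_max, NNReal.coe_mk]
  by_cases hx : x ∈ tsupport F
  · exact key x y hx
  by_cases hy : y ∈ tsupport F
  · rw [dist_comm, dist_comm x]
    exact key y x hy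
  · rw [image_eq_zero_of_notMem_tsupport hx, image_eq_zero_of_notMem_tsupport hy, dist_self]
    positivity

/-- Multiplying by a test function turns a field controlled only locally in Ω into a globally
Lipschitz one with compact support, to which integration by parts on the whole space applies. -/
theorem exists_lipschitzWith_smul (hΩ : IsOpen Ω) {g : Space d → Space d}
    (hg : LocallyLipschitzOn Ω g) {φ : Space d → ℝ} (hφ : ContDiff ℝ 1 φ)
    (hc : HasCompactSupport φ) (hs : tsupport φ ⊆ Ω) :
    ∃ K : ℝ≥0, LipschitzWith K (fun x => φ x • g x) := by
  refine exists_lipschitzWith_of_locallyLipschitz (fun x => ?_) hc.smul_right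
  by_cases hx : x ∈ Ω
  · obtain ⟨K, t, ht, hK⟩ := hg hx
    rw [hΩ.nhdsWithin_eq hx] at ht
    obtain ⟨L, hL⟩ := hφ.lipschitzWith_of_hasCompactSupport hc one_ne_zero
    obtain ⟨C, hC⟩ := hc.exists_bound_of_continuous hφ.continuous
    have hC0 : 0 ≤ C := (norm_nonneg _).trans (hC 0)
    have hgx : ContinuousAt g x := hK.continuousOn.continuousAt ht
    have hbd : ∀ᶠ y in nhds x, ‖g y‖ < ‖g x‖ + 1 :=
      hgx.norm.eventually_lt continuousAt_const (by simp)
    refine ⟨NNReal.mk C hC0 * K + L * (‖g x‖₊ + 1), t ∩ {y | ‖g y‖ < ‖g x‖ + 1},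
      Filter.inter_mem ht hbd, LipschitzOnWith.of_dist_le_mul fun y hy z hz => ?_⟩
    have e : φ y • g y - φ z • g z = φ y • (g y - g z) + (φ y - φ z) • g z := by
      rw [smul_sub, sub_smul]; abel
    rw [dist_eq_norm, e]
    have h1 : ‖g y - g z‖ ≤ K * dist y z := by
      rw [← dist_eq_norm]; exact hK.dist_le_mul y hy.1 z hz.1
    have h2 : ‖φ y - φ z‖ ≤ L * dist y z := by
      rw [← dist_eq_norm]; exact hL.dist_le_mul y z
    calc _ ≤ ‖φ y‖ * ‖g y - g z‖ + ‖φ y - φ z‖ * ‖g z‖ := by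
          refine (norm_add_le _ _).trans ?_
          rw [norm_smul, norm_smul]
      _ ≤ C * (K * dist y z) + (L * dist y z) * (‖g x‖ + 1) := by
          gcongr
          · exact hC y
          · exact hz.2.le
      _ = _ := by
          rw [NNReal.coe_add, NNReal.coe_mul, NNReal.coe_mul, NNReal.coe_mk, NNReal.coe_add,
            coe_nnnorm, NNReal.coe_one]
          ring
  · have hx' : x ∈ (tsupport φ)ᶜ := fun h => hx (hs h)
    refine ⟨0, (tsupport φ)ᶜ, (isClosed_tsupport φ).isOpen_compl.mem_nhds hx', ?_⟩
    refine LipschitzOnWith.of_dist_le_mul fun y hy z hz => ?_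
    simp [image_eq_zero_of_notMem_tsupport hy, image_eq_zero_of_notMem_tsupport hz]

/-- Integration by parts against the constant 1; the direction -v absorbs the sign in that formula.
-/
theorem integral_lineDeriv_eq_zero {F : Space d → ℝ} {K : ℝ≥0} (hF : LipschitzWith K F)
    (hc : HasCompactSupport F) (v : Space d) : ∫ x, lineDeriv ℝ F x v = 0 := by
  have h := LipschitzWith.integral_lineDeriv_mul_eq (μ := volume)
    (LipschitzWith.const (α := Space d) (1 : ℝ)) hF hc (-v)
  simpa [lineDeriv] using h.symm

theorem lineDeriv_eq_zero_of_notMem_tsupport {F : Space d → ℝ} {x : Space d} (hx : x ∉ tsupport F)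
    (v : Space d) : lineDeriv ℝ F x v = 0 := by
  have h : F =ᶠ[nhds x] fun _ => 0 := by
    filter_upwards [(isClosed_tsupport F).isOpen_compl.mem_nhds hx] with y hy
    exact image_eq_zero_of_notMem_tsupport hy
  simpa using (((hasFDerivAt_const (0 : ℝ) x).congr_of_eventuallyEq h).hasLineDerivAt v).lineDeriv

theorem integrable_lineDeriv {F : Space d → ℝ} {K : ℝ≥0} (hF : LipschitzWith K F)
    (hc : HasCompactSupport F) (v : Space d) : Integrable (fun x => lineDeriv ℝ F x v) := by
  rw [← integrableOn_iff_integrable_of_support_subset (s := tsupport F)]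
  · refine IntegrableOn.of_bound hc.isCompact.measure_lt_top
      (aestronglyMeasurable_lineDeriv hF.continuous _) (K * ‖v‖)
      (Filter.Eventually.of_forall fun x => norm_lineDeriv_le_of_lipschitz ℝ hF)
  · intro x hx
    by_contra h
    exact hx (lineDeriv_eq_zero_of_notMem_tsupport h v)

/-- The pointwise divergence of a locally Lipschitz vector field is its weak divergence. -/
theorem isWeakDiv_of_locallyLipschitzOn (hΩ : IsOpen Ω) {g : Space d → Space d}
    (hg : LocallyLipschitzOn Ω g) (hgi : Integrable g (volume.restrict Ω)) {f : Space d → ℝ}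
    (hf : Integrable f (volume.restrict Ω))
    (hgf : ∀ᵐ x ∂volume.restrict Ω, ∃ g', HasFDerivAt g g' x ∧ f x = diagSum g') :
    IsWeakDiv Ω g f := by
  intro φ hφ hc hs
  obtain ⟨K, hK⟩ := exists_lipschitzWith_smul hΩ hg hφ hc hs
  set F : Fin d → Space d → ℝ := fun i x => (φ x • g x) i with hF
  have hFL : ∀ i, LipschitzWith K (F i) := fun i => LipschitzWith.of_dist_le_mul fun x y => by
    refine le_trans ?_ (hK.dist_le_mul x y)
    rw [dist_eq_norm, dist_eq_norm]
    exact PiLp.norm_apply_le (φ x • g x - φ y • g y) i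
  have hFs : ∀ i, tsupport (F i) ⊆ tsupport φ := fun i => closure_mono fun x hx hx0 => hx (by
    simp [hF, hx0])
  have hFc : ∀ i, HasCompactSupport (F i) := fun i =>
    hc.of_isClosed_subset (isClosed_tsupport _) (hFs i)
  -- The integrand is div(φ g). By the product rule it equals g · ∇φ + f φ almost everywhere, so its
  -- vanishing integral is the claim.
  have hzero : ∫ x in Ω, ∑ i, lineDeriv ℝ (F i) x (EuclideanSpace.single i 1) = 0 := by
    rw [setIntegral_eq_integral_of_forall_compl_eq_zero, integral_finsetSum]
    · exact Finset.sum_eq_zero fun i _ => integral_lineDeriv_eq_zero (hFL i) (hFc i) _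
    · exact fun i _ => integrable_lineDeriv (hFL i) (hFc i) _
    · exact fun x hx => Finset.sum_eq_zero fun i _ =>
        lineDeriv_eq_zero_of_notMem_tsupport (fun h => hx (hs (hFs i h))) _
  have hae : ∀ᵐ x ∂volume.restrict Ω, ∑ i, lineDeriv ℝ (F i) x (EuclideanSpace.single i 1)
      = inner ℝ (g x) (gradient φ x) + f x * φ x := by
    filter_upwards [hgf] with x hx
    obtain ⟨g', hg', hfx⟩ := hx
    have hφx := (hφ.differentiable one_ne_zero x).hasFDerivAt
    have hsm := hφx.smul hg'
    have hi : ∀ i, lineDeriv ℝ (F i) x (EuclideanSpace.single i 1)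
        = φ x * g' (EuclideanSpace.single i 1) i
          + fderiv ℝ φ x (EuclideanSpace.single i 1) * g x i := fun i => by
      have := ((EuclideanSpace.proj (𝕜 := ℝ) i).hasFDerivAt.comp x hsm).hasLineDerivAt
        (EuclideanSpace.single i 1)
      rw [show F i = (EuclideanSpace.proj (𝕜 := ℝ) i) ∘ (φ • g) from rfl, this.lineDeriv]
      simp
    simp only [hi]
    rw [Finset.sum_add_distrib, ← Finset.mul_sum, inner_gradient_eq, hfx, diagSum]
    have hgx : g x = ∑ i, g x i • EuclideanSpace.single i (1 : ℝ) := by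
      ext j
      simp [Finset.sum_apply, Pi.single_apply]
    conv_rhs => rw [hgx]
    simp only [map_sum, map_smul, smul_eq_mul]
    rw [add_comm, mul_comm (φ x)]
    congr 1
    exact Finset.sum_congr rfl fun i _ => by rw [mul_comm]
  rw [integral_congr_ae hae, integral_add
    (integrable_inner_of_hasCompactSupport hgi (continuous_gradient hφ)
      (hasCompactSupport_gradient hc))
    (integrable_mul_of_hasCompactSupport hf hφ.continuous hc)] at hzero
  linarith

end Lipschitz

end DivFE

namespace DivFE

open scoped Convolution Manifold
open ContinuousLinearMap (lsmul)

/-! ### Density of smooth fields on Lipschitz domains -/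

section Density

variable {d : ℕ}

/-- The derivative falls on ρ, the trace passes under the integral, and the trace of the rank-one
map ∇ρ(z) ⊗ v(x - z) is ∇ρ(z) · v(x - z). This is the pairing in the definition of the weak
divergence. -/
theorem diagSum_fderiv_convolution {ρ : Space d → ℝ} (hρ : ContDiff ℝ 1 ρ)
    (hρc : HasCompactSupport ρ) {v : Space d → Space d} (hv : LocallyIntegrable v volume)
    (x : Space d) :
    diagSum (fderiv ℝ (ρ ⋆[lsmul ℝ ℝ, volume] v) x) = ∫ z, fderiv ℝ ρ z (v (x - z)) := by
  set L : (Space d →L[ℝ] Space d) →L[ℝ] ℝ := ∑ i, (EuclideanSpace.proj (𝕜 := ℝ) i).comp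
    (ContinuousLinearMap.apply ℝ (Space d) (EuclideanSpace.single i (1 : ℝ))) with hL
  have hLd : ∀ A, diagSum A = L A := fun A => by simp [hL, diagSum]
  have hint := (hρc.fderiv ℝ).convolutionExists_left ((lsmul ℝ ℝ).precompL (Space d))
    (hρ.continuous_fderiv one_ne_zero) hv x
  rw [(hρc.hasFDerivAt_convolution_left (lsmul ℝ ℝ) hρ hv x).fderiv, hLd, convolution_def,
    ← L.integral_comp_comm hint.integrable]
  refine integral_congr_ae (Filter.Eventually.of_forall fun z => ?_)
  simp only
  rw [← hLd, diagSum]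
  have hz : v (x - z) = ∑ i, v (x - z) i • EuclideanSpace.single i (1 : ℝ) := by
    ext j
    simp [Finset.sum_apply, Pi.single_apply]
  conv_rhs => rw [hz]
  simp only [map_sum, map_smul, smul_eq_mul]
  exact Finset.sum_congr rfl fun i _ => by
    simp [ContinuousLinearMap.precompL_apply, mul_comm]

/-- A compact set near which `Ω` can be pushed into its interior along a fixed direction, faster
than a fixed rate. -/
def PushesInside (Ω K : Set (Space d)) : Prop :=
  ∃ e : Space d, ∃ c > 0, ∃ η > 0, ∃ t₀ > 0, ∀ x ∈ Ω, (∃ k ∈ K, dist x k < η) →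
    ∀ t : ℝ, 0 < t → t < t₀ → Metric.closedBall (x + t • e) (c * t) ⊆ Ω

/-- Fields supported near a set from which one can push inside `Ω` are approximated by convolution
with an off-centre kernel. -/
theorem exists_contDiff_approx_of_pushesInside {p : ℝ≥0∞} (hp : 1 ≤ p) (hp' : p ≠ ∞)
    {Ω K : Set (Space d)} (hΩ : IsOpen Ω) (hb : Bornology.IsBounded Ω) (hK : PushesInside Ω K)
    {v : Space d → Space d} {g : Space d → ℝ} (hv : MemLp v p volume) (hg : MemLp g p volume)
    (hvg : IsWeakDiv Ω v g) (hvΩ : ∀ x ∉ Ω, v x = 0) (hgΩ : ∀ x ∉ Ω, g x = 0)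
    (hvK : ∀ x ∉ K, v x = 0) (hgK : ∀ x ∉ K, g x = 0) {ε : ℝ≥0∞} (hε : ε ≠ 0) :
    ∃ u : Space d → Space d, ContDiff ℝ 2 u ∧ HasCompactSupport u ∧
      eLpNorm (v - u) p (volume.restrict Ω) ≤ ε ∧
      eLpNorm (g - fun x => diagSum (fderiv ℝ u x)) p (volume.restrict Ω) ≤ ε := by
  obtain ⟨e, c, hc, η, hη, t₀, ht₀, hpush⟩ := hK
  obtain ⟨r₁, hr₁, h₁⟩ := exists_eLpNorm_convolution_sub_le hp hp' hv hε
  obtain ⟨r₂, hr₂, h₂⟩ := exists_eLpNorm_convolution_sub_le hp hp' hg hε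
  -- The kernel below is supported within t(‖e‖ + c) of the origin. This must be below r₁ and r₂ for
  -- L^p convergence, and below η so that points at distance at least η from K do not see v.
  obtain ⟨t, ht, htt₀, htr⟩ : ∃ t : ℝ, 0 < t ∧ t < t₀ ∧ t * (‖e‖ + c) < min η (min r₁ r₂) := by
    have hm : 0 < min η (min r₁ r₂) := by positivity
    have hec : 0 < ‖e‖ + c := by positivity
    refine ⟨min (t₀ / 2) (min η (min r₁ r₂) / (2 * (‖e‖ + c))), by positivity,
      (min_le_left _ _).trans_lt (by linarith), ?_⟩
    calc _ ≤ min η (min r₁ r₂) / (2 * (‖e‖ + c)) * (‖e‖ + c) := by gcongr; exact min_le_right _ _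
      _ = min η (min r₁ r₂) / 2 := by field_simp
      _ < _ := by linarith
  have hct : 0 < c * t := by positivity
  -- With centre -te, the points x - z at which v is sampled fill the ball about x + te of radius
  -- ct, which lies in Ω for x ∈ Ω near K.
  let b : ContDiffBump (-(t • e)) := ⟨c * t / 2, c * t, by positivity, by linarith⟩
  set ρ : Space d → ℝ := b.normed volume with hρdef
  have hρ : ∀ n : ℕ∞, ContDiff ℝ n ρ := fun n => b.contDiff_normed
  have hρc : HasCompactSupport ρ := b.hasCompactSupport_normed
  have hρt : tsupport ρ = Metric.closedBall (-(t • e)) (c * t) := b.tsupport_normed_eq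
  have hρnorm : ∀ z ∈ tsupport ρ, ‖z‖ ≤ t * (‖e‖ + c) := fun z hz => by
    rw [hρt, mem_closedBall_iff_norm, sub_neg_eq_add] at hz
    calc ‖z‖ = ‖(z + t • e) - t • e‖ := by rw [add_sub_cancel_right]
      _ ≤ c * t + ‖t • e‖ := (norm_sub_le _ _).trans (by gcongr)
      _ = t * (‖e‖ + c) := by rw [norm_smul, Real.norm_of_nonneg ht.le]; ring
  have hρr : ∀ r, t * (‖e‖ + c) < r → Function.support ρ ⊆ Metric.ball 0 r := fun r hr z hz => by
    rw [mem_ball_zero_iff]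
    exact (hρnorm z (subset_tsupport _ hz)).trans_lt hr
  have htη : t * (‖e‖ + c) < η := htr.trans_le (min_le_left _ _)
  have htr₁ : t * (‖e‖ + c) < r₁ := htr.trans_le ((min_le_right _ _).trans (min_le_left _ _))
  have htr₂ : t * (‖e‖ + c) < r₂ := htr.trans_le ((min_le_right _ _).trans (min_le_right _ _))
  have hvl := hv.locallyIntegrable hp
  have hvc : HasCompactSupport v := HasCompactSupport.intro' hb.isCompact_closure isClosed_closure
    fun x hx => hvΩ x fun h => hx (subset_closure h)
  refine ⟨ρ ⋆[lsmul ℝ ℝ, volume] v, ?_, hρc.convolution _ hvc, ?_, ?_⟩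
  · exact hρc.contDiff_convolution_left (lsmul ℝ ℝ) (n := 2) (hρ 2) hvl
  · refine (eLpNorm_mono_measure _ Measure.restrict_le_self).trans ?_
    rw [eLpNorm_sub_comm]
    exact h₁ ρ b.continuous_normed hρc b.nonneg_normed b.integral_normed (hρr r₁ htr₁)
  -- The identity holds on Ω even though v, extended by zero, need not have divergence g on the
  -- whole space. Near K the function y ↦ ρ(x - y) has support in Ω and can be used as test
  -- function; away from K both sides vanish.
  have hdiv : ∀ x ∈ Ω, diagSum (fderiv ℝ (ρ ⋆[lsmul ℝ ℝ, volume] v) x)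
      = (ρ ⋆[lsmul ℝ ℝ, volume] g) x := by
    intro x hx
    rw [diagSum_fderiv_convolution (hρ 1) hρc hvl, convolution_def]
    by_cases hxK : ∃ k ∈ K, dist x k < η
    · have hball := hpush x hx hxK t ht htt₀
      have hψ : ContDiff ℝ 1 (fun y => ρ (x - y)) := (hρ 1).comp (contDiff_const.sub contDiff_id)
      have hψs : tsupport (fun y => ρ (x - y)) ⊆ Metric.closedBall (x + t • e) (c * t) := by
        refine closure_minimal (fun y hy => ?_) Metric.isClosed_closedBall
        have : x - y ∈ tsupport ρ := subset_tsupport _ hy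
        rw [hρt, mem_closedBall_iff_norm] at this
        rwa [mem_closedBall_iff_norm, ← norm_neg,
          show -(y - (x + t • e)) = x - y - -(t • e) by abel]
      have hψc : HasCompactSupport (fun y => ρ (x - y)) :=
        (isCompact_closedBall _ _).of_isClosed_subset (isClosed_tsupport _) hψs
      have hψd : ∀ y, inner ℝ (v y) (gradient (fun y => ρ (x - y)) y)
          = -fderiv ℝ ρ (x - y) (v y) := fun y => by
        rw [inner_gradient_eq]
        have h := ((hρ 1).differentiable one_ne_zero (x - y)).hasFDerivAt.comp y
          ((hasFDerivAt_const x y).sub (hasFDerivAt_id y))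
        have h' := h.fderiv
        change fderiv ℝ (fun y => ρ (x - y)) y = _ at h'
        rw [h']
        simp
      have key := hvg _ hψ hψc (hψs.trans hball)
      simp only [hψd] at key
      rw [integral_neg, neg_inj] at key
      rw [← integral_sub_left_eq_self (fun z => fderiv ℝ ρ z (v (x - z))) volume x,
        ← integral_sub_left_eq_self (fun z => lsmul ℝ ℝ (ρ z) (g (x - z))) volume x]
      simp only [sub_sub_cancel, ContinuousLinearMap.lsmul_apply, smul_eq_mul]
      rw [setIntegral_eq_integral_of_forall_compl_eq_zero (fun y hy => by rw [hvΩ y hy, map_zero]),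
        setIntegral_eq_integral_of_forall_compl_eq_zero (fun y hy => by rw [hgΩ y hy, zero_mul])]
        at key
      rw [key]
      exact integral_congr_ae (Filter.Eventually.of_forall fun y => mul_comm _ _)
    · push Not at hxK
      have hout : ∀ z ∈ tsupport ρ, x - z ∉ K := fun z hz hzK => by
        have := hxK _ hzK
        rw [dist_eq_norm, sub_sub_cancel] at this
        linarith [hρnorm z hz]
      have e1 : ∀ z, fderiv ℝ ρ z (v (x - z)) = 0 := fun z => by
        by_cases hz : z ∈ tsupport ρ
        · rw [hvK _ (hout z hz), map_zero]
        · rw [fderiv_of_notMem_tsupport ℝ hz, zero_apply]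
      have e2 : ∀ z, lsmul ℝ ℝ (ρ z) (g (x - z)) = 0 := fun z => by
        by_cases hz : z ∈ tsupport ρ
        · rw [hgK _ (hout z hz), map_zero]
        · rw [image_eq_zero_of_notMem_tsupport hz]; simp
      simp only [e1, e2]
  have hae : (g - fun x => diagSum (fderiv ℝ (ρ ⋆[lsmul ℝ ℝ, volume] v) x))
      =ᵐ[volume.restrict Ω] (g - (ρ ⋆[lsmul ℝ ℝ, volume] g)) := by
    filter_upwards [ae_restrict_mem hΩ.measurableSet] with x hx
    rw [Pi.sub_apply, Pi.sub_apply, hdiv x hx]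
  rw [eLpNorm_congr_ae hae, eLpNorm_sub_comm]
  refine (eLpNorm_mono_measure _ Measure.restrict_le_self).trans ?_
  exact h₂ ρ b.continuous_normed hρc b.nonneg_normed b.integral_normed (hρr r₂ htr₂)

theorem pushesInside_of_subset_isOpen {Ω K : Set (Space d)} (hΩ : IsOpen Ω) (hK : IsCompact K)
    (hKΩ : K ⊆ Ω) : PushesInside Ω K := by
  obtain ⟨δ, hδ, hδΩ⟩ := hK.exists_cthickening_subset_open hΩ hKΩ
  refine ⟨0, 1, one_pos, δ / 2, by positivity, δ / 2, by positivity, ?_⟩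
  rintro x - ⟨k, hk, hxk⟩ t ht htδ y hy
  rw [smul_zero, add_zero, one_mul, Metric.mem_closedBall] at hy
  refine hδΩ (Metric.mem_cthickening_of_dist_le y k δ K hk ?_)
  linarith [dist_triangle y x k]

/-- The shift te raises the height by t and leaves the projection fixed. A perturbation of size ct
lowers the height by at most ct and raises the graph by at most Lct. For c = 1/(2(1 + L)) the total
loss is t/2 < t. Since c ≤ 1, the three thirds of δ keep all points in the ball where the graph
describes Ω. -/
theorem pushesInside_of_graph {Ω K : Set (Space d)} {x₀ : Space d} {r : ℝ} {e : Space d}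
    (he : ‖e‖ = 1) {L : ℝ≥0} {γ : (Submodule.span ℝ {e})ᗮ → ℝ} (hγ : LipschitzWith L γ)
    (h : ∀ y ∈ Metric.ball x₀ r,
      (y ∈ Ω ↔ γ ((Submodule.span ℝ {e})ᗮ.orthogonalProjectionOnto y) < inner ℝ e y))
    (hK : IsCompact K) (hKx : K ⊆ Metric.ball x₀ r) : PushesInside Ω K := by
  obtain ⟨δ, hδ, hδΩ⟩ := hK.exists_cthickening_subset_open Metric.isOpen_ball hKx
  have hc1 : 1 / (2 * (1 + (L : ℝ))) ≤ 1 := by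
    rw [div_le_one (by positivity)]
    linarith [L.coe_nonneg]
  refine ⟨e, 1 / (2 * (1 + L)), by positivity, δ / 3, by positivity, δ / 3, by positivity, ?_⟩
  rintro x hx ⟨k, hk, hxk⟩ t ht htδ y hy
  set P := (Submodule.span ℝ {e})ᗮ.orthogonalProjectionOnto with hP
  set c : ℝ := 1 / (2 * (1 + L)) with hc
  obtain ⟨w, rfl⟩ : ∃ w, y = x + t • e + w := ⟨y - (x + t • e), by abel⟩
  have hw : ‖w‖ ≤ c * t := by simpa [mem_closedBall_iff_norm] using hy
  have hct : c * t ≤ 1 * t := by gcongr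
  have hxball : x ∈ Metric.ball x₀ r :=
    hδΩ (Metric.mem_cthickening_of_dist_le x k δ K hk (by linarith))
  have hyx : dist (x + t • e + w) x ≤ t + c * t := by
    rw [dist_eq_norm, add_assoc, add_sub_cancel_left]
    refine (norm_add_le _ _).trans ?_
    rw [norm_smul, he, Real.norm_of_nonneg ht.le, mul_one]
    gcongr
  have hyball : x + t • e + w ∈ Metric.ball x₀ r :=
    hδΩ (Metric.mem_cthickening_of_dist_le _ k δ K hk
      (by linarith [dist_triangle (x + t • e + w) x k]))
  have hxγ := (h x hxball).1 hx
  refine (h _ hyball).2 ?_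
  have hPe : P e = 0 := by
    rw [hP, Submodule.orthogonalProjectionOnto_eq_zero_iff]
    exact Submodule.le_orthogonal_orthogonal _ (Submodule.mem_span_singleton_self e)
  have hPy : P (x + t • e + w) = P x + P w := by
    rw [map_add, map_add, map_smul, hPe, smul_zero, add_zero]
  have hPw : ‖P w‖ ≤ ‖w‖ := Submodule.norm_orthogonalProjectionOnto_apply_le _ w
  have h1 : γ (P (x + t • e + w)) ≤ γ (P x) + L * (c * t) := by
    have h2 := hγ.dist_le_mul (P (x + t • e + w)) (P x)
    rw [Real.dist_eq, dist_eq_norm, hPy, add_sub_cancel_left] at h2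
    rw [hPy]
    have h3 : L * ‖P w‖ ≤ L * (c * t) := by gcongr; exact hPw.trans hw
    linarith [le_abs_self (γ (P x + P w) - γ (P x))]
  have h4 : inner ℝ e (x + t • e + w) ≥ inner ℝ e x + t - c * t := by
    rw [inner_add_right, inner_add_right, real_inner_smul_right, real_inner_self_eq_norm_sq, he]
    have := (abs_le.1 ((abs_real_inner_le_norm e w).trans (by rw [he, one_mul]))).1
    linarith
  have h5 : c * (1 + L) = 1 / 2 := by
    rw [hc]; field_simp
  nlinarith

/-- Near every point of its closure, a Lipschitz domain can be pushed inside itself. -/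
theorem exists_nhd_pushesInside {Ω : Set (Space d)} (hΩ : IsOpen Ω)
    (hb : Bornology.IsBounded Ω) (hL : HasLipschitzBoundary Ω) {x : Space d}
    (hx : x ∈ closure Ω) :
    ∃ U : Set (Space d), IsOpen U ∧ x ∈ U ∧ Bornology.IsBounded U ∧
      ∀ K, IsCompact K → K ⊆ U → PushesInside Ω K := by
  by_cases hxΩ : x ∈ Ω
  · exact ⟨Ω, hΩ, hxΩ, hb, fun K hK hKΩ => pushesInside_of_subset_isOpen hΩ hK hKΩ⟩
  · obtain ⟨r, hr, e, he, L, γ, hγ, h⟩ := hL x ⟨hx, by rwa [hΩ.interior_eq]⟩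
    exact ⟨Metric.ball x r, Metric.isOpen_ball, Metric.mem_ball_self hr, Metric.isBounded_ball,
      fun K hK hKx => pushesInside_of_graph he hγ h hK hKx⟩

/-- A partition of unity on the closure of a Lipschitz domain, subordinate to sets from which one
can push inside. -/
theorem exists_partition_pushesInside {Ω : Set (Space d)} (hΩ : IsOpen Ω)
    (hb : Bornology.IsBounded Ω) (hL : HasLipschitzBoundary Ω) :
    ∃ (ι : Type) (_ : Fintype ι) (φ : ι → Space d → ℝ), (∀ i, ContDiff ℝ 1 (φ i)) ∧
      (∀ i, HasCompactSupport (φ i)) ∧ (∀ i, PushesInside Ω (tsupport (φ i))) ∧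
      ∀ x ∈ Ω, ∑ i, φ i x = 1 := by
  choose! U hUo hxU hUb hUp using fun x (hx : x ∈ closure Ω) => exists_nhd_pushesInside hΩ hb hL hx
  obtain ⟨t, ht, hcov⟩ := hb.isCompact_closure.elim_nhds_subcover U
    fun x hx => (hUo x hx).mem_nhds (hxU x hx)
  obtain ⟨f, hf⟩ := SmoothPartitionOfUnity.exists_isSubordinate 𝓘(ℝ, Space d)
    (isClosed_closure (s := Ω)) (fun i : t => U i) (fun i => hUo i (ht i i.2))
    (by simpa [Set.iUnion_subtype] using hcov)
  have hcs : ∀ i, HasCompactSupport (f i) := fun i =>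
    Metric.isCompact_of_isClosed_isBounded (isClosed_tsupport _)
      ((hUb i (ht i i.2)).subset (hf i))
  let s := Fintype.equivFin t
  refine ⟨Fin (Fintype.card t), inferInstance, fun i => f (s.symm i), fun i => ?_,
    fun i => hcs _, fun i => hUp _ (ht _ (s.symm i).2) _ (hcs _) (hf _), fun x hx => ?_⟩
  · exact ((f (s.symm i)).contMDiff.contDiff).of_le (by exact_mod_cast le_top)
  · rw [s.symm.sum_comp (fun i => f i x), ← finsum_eq_sum_of_fintype]
    exact f.sum_eq_one (subset_closure hx)

/-- Smooth fields are dense in `W^p(div; Ω)` on Lipschitz domains. -/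
theorem exists_contDiff_approx {p : ℝ≥0∞} (hp : 1 ≤ p) (hp' : p ≠ ∞) {Ω : Set (Space d)}
    (hΩ : IsOpen Ω) (hb : Bornology.IsBounded Ω) (hL : HasLipschitzBoundary Ω)
    {v : Space d → Space d} {f : Space d → ℝ} (hv : MemLp v p (volume.restrict Ω))
    (hf : MemLp f p (volume.restrict Ω)) (hvf : IsWeakDiv Ω v f) {ε : ℝ≥0∞} (hε : ε ≠ 0) :
    ∃ u : Space d → Space d, ContDiff ℝ 2 u ∧ HasCompactSupport u ∧
      eLpNorm (v - u) p (volume.restrict Ω) ≤ ε ∧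
      eLpNorm (f - fun x => diagSum (fderiv ℝ u x)) p (volume.restrict Ω) ≤ ε := by
  have hfin : IsFiniteMeasure (volume.restrict Ω) := ⟨by
    rw [Measure.restrict_apply_univ]; exact hb.measure_lt_top⟩
  obtain ⟨ι, _, φ, hφ, hφc, hφp, hφ1⟩ := exists_partition_pushesInside hΩ hb hL
  have hvi := hv.integrable hp
  have hfi := hf.integrable hp
  set V : ι → Space d → Space d := fun i => Ω.indicator fun x => φ i x • v x with hV
  set G : ι → Space d → ℝ := fun i => Ω.indicator fun x =>
    φ i x * f x + inner ℝ (v x) (gradient (φ i) x) with hG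
  have hVm : ∀ i, MemLp (V i) p volume := fun i => by
    obtain ⟨C, hC⟩ := (hφc i).exists_bound_of_continuous (hφ i).continuous
    rw [hV, memLp_indicator_iff_restrict hΩ.measurableSet]
    refine hv.of_le_mul (c := C) ((hφ i).continuous.aestronglyMeasurable.smul hv.1)
      (Filter.Eventually.of_forall fun x => ?_)
    rw [norm_smul]
    gcongr
    exact hC x
  have hGm : ∀ i, MemLp (G i) p volume := fun i => by
    obtain ⟨C, hC⟩ := (hφc i).exists_bound_of_continuous (hφ i).continuous
    obtain ⟨D, hD⟩ := (hasCompactSupport_gradient (hφc i)).exists_bound_of_continuous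
      (continuous_gradient (hφ i))
    rw [hG, memLp_indicator_iff_restrict hΩ.measurableSet]
    refine MemLp.add (hf.of_le_mul (c := C) ((hφ i).continuous.aestronglyMeasurable.mul hf.1)
      (Filter.Eventually.of_forall fun x => ?_)) (hv.of_le_mul (c := D)
        (hv.1.inner (continuous_gradient (hφ i)).aestronglyMeasurable)
        (Filter.Eventually.of_forall fun x => ?_))
    · rw [norm_mul]
      gcongr
      exact hC x
    · rw [mul_comm]
      exact (norm_inner_le_norm _ _).trans (by gcongr; exact hD x)
  have hVG : ∀ i, IsWeakDiv Ω (V i) (G i) := fun i =>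
    (hvf.smul hvi hfi (hφ i)).congr (indicator_ae_eq_restrict hΩ.measurableSet).symm
      (indicator_ae_eq_restrict hΩ.measurableSet).symm
  have hN : (Fintype.card ι : ℝ≥0∞) ≠ ∞ := ENNReal.natCast_ne_top _
  -- An empty index set does no harm: the quotient is then ∞, still nonzero, and the sum of errors
  -- is empty.
  have hεN : ε / Fintype.card ι ≠ 0 := ENNReal.div_ne_zero.2 ⟨hε, hN⟩
  choose u hu huc hVu hGu using fun i =>
    exists_contDiff_approx_of_pushesInside hp hp' hΩ hb (hφp i) (hVm i) (hGm i) (hVG i)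
      (fun x hx => Set.indicator_of_notMem hx _) (fun x hx => Set.indicator_of_notMem hx _)
      (fun x hx => Set.indicator_apply_eq_zero.2 fun _ => by
        rw [image_eq_zero_of_notMem_tsupport hx, zero_smul])
      (fun x hx => Set.indicator_apply_eq_zero.2 fun _ => by
        rw [image_eq_zero_of_notMem_tsupport hx, inner_gradient_eq, fderiv_of_notMem_tsupport ℝ hx]
        simp) hεN
  have hsum : ∑ _i : ι, ε / Fintype.card ι ≤ ε := by
    rw [Finset.sum_const, Finset.card_univ, nsmul_eq_mul]
    exact ENNReal.mul_div_le
  have hdiff : ∀ i, Differentiable ℝ (u i) := fun i => (hu i).differentiable two_ne_zero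
  have hdivc : ∀ i, Continuous fun x => diagSum (fderiv ℝ (u i) x) := fun i =>
    continuous_diagSum.comp ((hu i).continuous_fderiv two_ne_zero)
  refine ⟨fun x => ∑ i, u i x, ContDiff.sum fun i _ => hu i, ?_, ?_, ?_⟩
  · refine HasCompactSupport.intro (K := ⋃ i, tsupport (u i)) (isCompact_iUnion huc)
      fun x hx => Finset.sum_eq_zero fun i _ => image_eq_zero_of_notMem_tsupport fun h =>
        hx (Set.mem_iUnion.2 ⟨i, h⟩)
  · have hae : (v - fun x => ∑ i, u i x) =ᵐ[volume.restrict Ω] ∑ i, (V i - u i) := by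
      filter_upwards [ae_restrict_mem hΩ.measurableSet] with x hx
      simp only [Pi.sub_apply, Finset.sum_apply, Finset.sum_sub_distrib]
      congr 1
      simp only [hV, Set.indicator_of_mem hx]
      rw [← Finset.sum_smul, hφ1 x hx, one_smul]
    rw [eLpNorm_congr_ae hae]
    refine (eLpNorm_sum_le (fun i _ => ?_) hp).trans
      ((Finset.sum_le_sum fun i _ => hVu i).trans hsum)
    exact ((hVm i).1.restrict).sub (hu i).continuous.aestronglyMeasurable
  · have hae : (f - fun x => diagSum (fderiv ℝ (fun x => ∑ i, u i x) x)) =ᵐ[volume.restrict Ω]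
        ∑ i, (G i - fun x => diagSum (fderiv ℝ (u i) x)) := by
      filter_upwards [ae_restrict_mem hΩ.measurableSet] with x hx
      have hd : diagSum (fderiv ℝ (fun x => ∑ i, u i x) x) = ∑ i, diagSum (fderiv ℝ (u i) x) := by
        rw [fderiv_fun_sum fun i _ => hdiff i x]
        simp only [diagSum, sum_apply]
        rw [Finset.sum_comm]
        refine Finset.sum_congr rfl fun i _ => ?_
        simp
      -- The partition sums to 1 on a whole neighbourhood of x, as Ω is open. This removes the
      -- cutoff terms from ∑ G_i.
      have hgr : ∑ i, fderiv ℝ (φ i) x = 0 := by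
        rw [← fderiv_fun_sum fun i _ => (hφ i).differentiable one_ne_zero x]
        have : (fun y => ∑ i, φ i y) =ᶠ[nhds x] fun _ => 1 := by
          filter_upwards [hΩ.mem_nhds hx] with y hy using hφ1 y hy
        rw [this.fderiv_eq, fderiv_const_apply]
      simp only [Pi.sub_apply, Finset.sum_apply, Finset.sum_sub_distrib]
      rw [hd]
      congr 1
      simp only [hG, Set.indicator_of_mem hx, inner_gradient_eq]
      rw [Finset.sum_add_distrib, ← Finset.sum_mul, hφ1 x hx, one_mul,
        ← sum_apply, hgr, zero_apply, add_zero]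
    rw [eLpNorm_congr_ae hae]
    refine (eLpNorm_sum_le (fun i _ => ?_) hp).trans
      ((Finset.sum_le_sum fun i _ => hGu i).trans hsum)
    exact ((hGm i).1.restrict).sub (hdivc i).aestronglyMeasurable

end Density

end DivFE

namespace DivFE

/-! ### Nodal interpolation and piecewise affine fields -/

section Interpolation

variable {d : ℕ}

/-- The linear part of an affine map between Euclidean spaces, as a continuous linear map. -/
noncomputable def affineDeriv (A : Space d →ᵃ[ℝ] Space d) : Space d →L[ℝ] Space d :=
  LinearMap.toContinuousLinearMap A.linear

theorem affineMap_sub_eq (A : Space d →ᵃ[ℝ] Space d) (x y : Space d) :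
    A x - A y = affineDeriv A (x - y) := by
  simpa [affineDeriv] using (A.linearMap_vsub x y).symm

theorem hasFDerivAt_affineMap (A : Space d →ᵃ[ℝ] Space d) (x : Space d) :
    HasFDerivAt A (affineDeriv A) x := by
  have h : (A : Space d → Space d) = fun y => affineDeriv A y + A 0 := funext fun y => by
    rw [← sub_eq_iff_eq_add, affineMap_sub_eq, sub_zero]
  rw [h]
  exact (affineDeriv A).hasFDerivAt.add_const _

theorem exists_affineMap_eq_of_affineIndependent {s : Finset (Space d)} (hs : s.card = d + 1)
    (hi : AffineIndependent ℝ ((↑) : s → Space d)) (u : Space d → Space d) :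
    ∃ A : Space d →ᵃ[ℝ] Space d, ∀ v ∈ s, A v = u v := by
  have htop : affineSpan ℝ (Set.range ((↑) : s → Space d)) = ⊤ := by
    rw [hi.affineSpan_eq_top_iff_card_eq_finrank_add_one]
    simp [hs]
  let b : AffineBasis s ℝ (Space d) := ⟨_, hi, htop⟩
  let A : Space d →ᵃ[ℝ] Space d :=
    { toFun := fun x => ∑ i : s, b.coord i x • u i
      linear := ∑ i : s, (b.coord i).linear.smulRight (u i)
      map_vadd' := fun x w => by
        have h : ∀ i, b.coord i (w + x) = (b.coord i).linear w + b.coord i x := fun i =>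
          (b.coord i).map_vadd x w
        simp only [vadd_eq_add, h, add_smul, Finset.sum_add_distrib,
          LinearMap.sum_apply, LinearMap.smulRight_apply] }
  refine ⟨A, fun v hv => ?_⟩
  have hb : b ⟨v, hv⟩ = v := rfl
  change ∑ i : s, b.coord i v • u i = u v
  rw [Finset.sum_eq_single (⟨v, hv⟩ : s)]
  · rw [show b.coord ⟨v, hv⟩ v = 1 from b.coord_apply_eq ⟨v, hv⟩, one_smul]
  · intro i _ hne
    rw [← hb, b.coord_apply_ne hne, zero_smul]
  · simp

theorem IsTriangulation.closure_eq_biUnion {K : Geometry.SimplicialComplex ℝ (Space d)}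
    {Ω : Set (Space d)} (hK : IsTriangulation K Ω) :
    closure Ω = ⋃ s ∈ elements K, convexHull ℝ (s : Set (Space d)) := by
  rw [← hK.space_eq]
  refine Set.Subset.antisymm (fun x hx => ?_) (Set.iUnion₂_subset fun s hs =>
    K.convexHull_subset_space hs.1)
  obtain ⟨t, ht, hxt⟩ := K.mem_space_iff.1 hx
  obtain ⟨s, hs, hts⟩ := hK.pure t ht
  exact Set.mem_iUnion₂.2 ⟨s, hs, convexHull_mono (by exact_mod_cast hts) hxt⟩

theorem isClosed_convexHull_finset (s : Finset (Space d)) :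
    IsClosed (convexHull ℝ (s : Set (Space d))) :=
  (s.finite_toSet.isCompact_convexHull ℝ).isClosed

theorem IsTriangulation.finite_elements {K : Geometry.SimplicialComplex ℝ (Space d)}
    {Ω : Set (Space d)} (hK : IsTriangulation K Ω) : (elements K).Finite :=
  hK.finite.subset fun _ hs => hs.1

/-- The nodal interpolant of a vector field on a triangulation. -/
theorem IsTriangulation.exists_interpolant {K : Geometry.SimplicialComplex ℝ (Space d)}
    {Ω : Set (Space d)} (hK : IsTriangulation K Ω) (u : Space d → Space d) :
    ∃ q : Space d → Space d, MemS1 K Ω q ∧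
      ∀ s ∈ elements K, ∀ v ∈ s, q v = u v := by
  classical
  choose! A hA using fun s (hs : s ∈ elements K) =>
    exists_affineMap_eq_of_affineIndependent hs.2 (K.indep hs.1) u
  -- Conformity: two elements meet only in the hull of their common vertices, where both affine maps
  -- are determined by the same nodal values.
  have hagree : ∀ s ∈ elements K, ∀ t ∈ elements K, ∀ x ∈ convexHull ℝ (s : Set (Space d)),
      x ∈ convexHull ℝ (t : Set (Space d)) → A s x = A t x := by
    intro s hs t ht x hxs hxt
    have hx := K.inter_subset_convexHull hs.1 ht.1 ⟨hxs, hxt⟩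
    have heq : Set.EqOn (A s) (A t) ((s : Set (Space d)) ∩ t) := fun v hv => by
      rw [hA s hs v hv.1, hA t ht v hv.2]
    exact AffineMap.eqOn_affineSpan heq (convexHull_subset_affineSpan _ hx)
  let q : Space d → Space d := fun x =>
    if h : ∃ s ∈ elements K, x ∈ convexHull ℝ (s : Set (Space d)) then A h.choose x else 0
  have hq : ∀ s ∈ elements K, Set.EqOn q (A s) (convexHull ℝ (s : Set (Space d))) := by
    intro s hs x hx
    have h : ∃ s ∈ elements K, x ∈ convexHull ℝ (s : Set (Space d)) := ⟨s, hs, hx⟩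
    change (if h : ∃ s ∈ elements K, x ∈ convexHull ℝ (s : Set (Space d))
      then A h.choose x else 0) = _
    rw [dif_pos h]
    exact hagree _ h.choose_spec.1 s hs x h.choose_spec.2 hx
  refine ⟨q, ⟨?_, fun s hs => ⟨A s, hq s hs⟩⟩, fun s hs v hv => ?_⟩
  · have := hK.finite_elements.to_subtype
    rw [hK.closure_eq_biUnion, Set.biUnion_eq_iUnion]
    exact (locallyFinite_of_finite _).continuousOn_iUnion
      (fun s => isClosed_convexHull_finset s.1) fun s =>
        ((A s).continuous_of_finiteDimensional.continuousOn).congr (hq s s.2)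
  · rw [hq s hs (subset_convexHull ℝ _ hv), hA s hs v hv]

/-- A continuous map on a segment covered by finitely many closed sets on each of which it is
`C`-Lipschitz is `C`-Lipschitz. -/
theorem dist_le_of_segment_subset_iUnion {E F : Type*} [NormedAddCommGroup E] [NormedSpace ℝ E]
    [NormedAddCommGroup F] {ι : Type*} [Finite ι] {S : ι → Set E} (hS : ∀ i, IsClosed (S i))
    {g : E → F} {C : ℝ≥0} (hC : ∀ i, LipschitzOnWith C g (S i)) {x y : E}
    (hxy : segment ℝ x y ⊆ ⋃ i, S i) :
    dist (g x) (g y) ≤ C * dist x y := by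
  set c : ℝ → E := ⇑(AffineMap.lineMap (k := ℝ) x y) with hc
  have hcc : Continuous c := AffineMap.lineMap_continuous
  have hcS : ∀ t ∈ Set.Icc (0 : ℝ) 1, ∃ i, c t ∈ S i := fun t ht => by
    refine Set.mem_iUnion.1 (hxy ?_)
    rw [segment_eq_image_lineMap]
    exact ⟨t, ht, rfl⟩
  have hcd : ∀ s t, dist (c s) (c t) = dist s t * dist x y := fun s t =>
    dist_lineMap_lineMap x y s t
  have hgc : ContinuousOn g (⋃ i, S i) :=
    (locallyFinite_of_finite _).continuousOn_iUnion hS fun i => (hC i).continuousOn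
  have hf : ContinuousOn (fun t => g (c t) - g x) (Set.Icc 0 1) :=
    (hgc.comp hcc.continuousOn fun t ht => Set.mem_iUnion.2 (hcS t ht)).sub continuousOn_const
  refine le_of_forall_pos_le_add fun ε hε => ?_
  -- This mean value inequality needs slope bounds only for some z arbitrarily close to t on the
  -- right. The slack ε provides its strict inequality of derivatives.
  have key := image_norm_le_of_liminf_right_slope_norm_lt_deriv_boundary (a := 0) (b := 1)
    (f := fun t => g (c t) - g x) (f' := fun _ => C * dist x y)
    (B := fun t => (C * dist x y + ε) * t) (B' := fun _ => C * dist x y + ε) hf ?_ ?_ ?_ ?_ ?_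
    (Set.right_mem_Icc.2 zero_le_one)
  · have h1 : c 1 = y := AffineMap.lineMap_apply_one x y
    simp only [h1, mul_one] at key
    rwa [dist_comm, dist_eq_norm]
  · intro t ht r hr
    -- By finiteness one piece contains c z for such z, and being closed it also contains c t. Its
    -- Lipschitz bound then controls these slopes.
    have hex : ∃ i, ∃ᶠ z in nhdsWithin t (Set.Ioi t), c z ∈ S i := by
      by_contra! h
      have h2 : ∀ᶠ z in nhdsWithin t (Set.Ioi t), z ∈ Set.Ioc t 1 :=
        Ioc_mem_nhdsGT ht.2
      obtain ⟨z, hz, hz'⟩ := ((Filter.eventually_all.2 h).and h2).exists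
      obtain ⟨i, hi⟩ := hcS z ⟨ht.1.trans hz'.1.le, hz'.2⟩
      exact hz i hi
    obtain ⟨i, hi⟩ := hex
    have hti : c t ∈ S i := (hS i).mem_of_frequently_of_tendsto hi
      (hcc.continuousAt.tendsto.mono_left nhdsWithin_le_nhds)
    refine (hi.and_eventually self_mem_nhdsWithin).mono fun z hz => ?_
    have hzt : 0 < z - t := sub_pos.2 hz.2
    refine lt_of_le_of_lt ?_ hr
    rw [slope_def_field, div_le_iff₀ hzt]
    have h3 : ‖g (c z) - g (c t)‖ ≤ C * (dist z t * dist x y) := by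
      rw [← hcd, ← dist_eq_norm]
      exact (hC i).dist_le_mul _ hz.1 _ hti
    rw [Real.dist_eq, abs_of_pos hzt] at h3
    have h4 := norm_sub_norm_le (g (c z) - g x) (g (c t) - g x)
    rw [sub_sub_sub_cancel_right] at h4
    simp only [Function.comp]
    linarith
  · have h0 : c 0 = x := AffineMap.lineMap_apply_zero x y
    simp [h0]
  · fun_prop
  · intro t _
    simpa using ((hasDerivAt_id t).const_mul (C * dist x y + ε)).hasDerivWithinAt
  · intro t _ _
    linarith

/-- Piecewise affine fields are locally Lipschitz in the domain. -/
theorem MemS1.locallyLipschitzOn {K : Geometry.SimplicialComplex ℝ (Space d)}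
    {Ω : Set (Space d)} (hΩ : IsOpen Ω) (hK : IsTriangulation K Ω) {q : Space d → Space d}
    (hq : MemS1 K Ω q) : LocallyLipschitzOn Ω q := by
  choose! A hA using hq.2
  have := hK.finite_elements.to_subtype
  obtain ⟨C, hC⟩ : ∃ C : ℝ≥0, ∀ s ∈ elements K, ‖affineDeriv (A s)‖₊ ≤ C := by
    obtain ⟨C, hC⟩ := (hK.finite_elements.image fun s => ‖affineDeriv (A s)‖₊).bddAbove
    exact ⟨C, fun s hs => hC ⟨s, hs, rfl⟩⟩
  have hL : ∀ s : elements K, LipschitzOnWith C q (convexHull ℝ (s.1 : Set (Space d))) :=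
    fun s => LipschitzOnWith.of_dist_le_mul fun x hx y hy => by
      rw [hA s s.2 hx, hA s s.2 hy, dist_eq_norm, affineMap_sub_eq, dist_eq_norm]
      exact (affineDeriv (A s)).le_of_opNorm_le (hC s s.2) _
  intro x hx
  obtain ⟨r, hr, hrΩ⟩ := Metric.isOpen_iff.1 hΩ x hx
  refine ⟨C, Metric.ball x r, mem_nhdsWithin_of_mem_nhds (Metric.ball_mem_nhds x hr), ?_⟩
  refine LipschitzOnWith.of_dist_le_mul fun y hy z hz => ?_
  -- Ω need not be convex, but a ball inside it is, so the segment from y to z stays in the union of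
  -- the elements.
  refine dist_le_of_segment_subset_iUnion
    (S := fun s : elements K => convexHull ℝ (s.1 : Set (Space d)))
    (fun s => isClosed_convexHull_finset s.1) hL ?_
  rw [← Set.biUnion_eq_iUnion (elements K) fun s _ => convexHull ℝ (s : Set (Space d)),
    ← hK.closure_eq_biUnion]
  exact ((convex_ball x r).segment_subset hy hz).trans (hrΩ.trans subset_closure)

/-- Almost every point of the domain has a neighbourhood contained in one element. -/
theorem IsTriangulation.ae_exists_mem_interior {K : Geometry.SimplicialComplex ℝ (Space d)}
    {Ω : Set (Space d)} (hΩ : IsOpen Ω) (hK : IsTriangulation K Ω) :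
    ∀ᵐ x ∂volume.restrict Ω, ∃ s ∈ elements K,
      x ∈ interior (convexHull ℝ (s : Set (Space d))) := by
  have h : ∀ᵐ x ∂volume.restrict Ω, ∀ s ∈ elements K,
      x ∉ frontier (convexHull ℝ (s : Set (Space d))) := by
    refine ae_restrict_of_ae ((ae_ball_iff hK.finite_elements.countable).2 fun s _ => ?_)
    exact measure_eq_zero_iff_ae_notMem.1 ((convex_convexHull ℝ _).addHaar_frontier volume)
  filter_upwards [h, ae_restrict_mem hΩ.measurableSet] with x hx hxΩ
  have hxc := subset_closure hxΩ
  rw [hK.closure_eq_biUnion] at hxc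
  obtain ⟨s, hs, hxs⟩ := Set.mem_iUnion₂.1 hxc
  refine ⟨s, hs, ?_⟩
  by_contra hn
  exact hx s hs ⟨subset_closure hxs, hn⟩

/-- The a.e. divergence of a piecewise affine field is bounded and is its weak divergence. -/
theorem MemS1.isWeakDiv {K : Geometry.SimplicialComplex ℝ (Space d)} {Ω : Set (Space d)}
    (hΩ : IsOpen Ω) (hb : Bornology.IsBounded Ω) (hK : IsTriangulation K Ω)
    {q : Space d → Space d} (hq : MemS1 K Ω q) (p : ℝ≥0∞) :
    MemLp q p (volume.restrict Ω) ∧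
      MemLp (fun x => diagSum (fderiv ℝ q x)) p (volume.restrict Ω) ∧
      IsWeakDiv Ω q (fun x => diagSum (fderiv ℝ q x)) := by
  have hfin : IsFiniteMeasure (volume.restrict Ω) := ⟨by
    rw [Measure.restrict_apply_univ]; exact hb.measure_lt_top⟩
  have hLip := hq.locallyLipschitzOn hΩ hK
  have hae : ∀ᵐ x ∂volume.restrict Ω, ∃ s ∈ elements K, ∃ A : Space d →ᵃ[ℝ] Space d,
      Set.EqOn q A (convexHull ℝ (s : Set (Space d))) ∧ HasFDerivAt q (affineDeriv A) x := by
    filter_upwards [hK.ae_exists_mem_interior hΩ] with x hx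
    obtain ⟨s, hs, hxs⟩ := hx
    obtain ⟨A, hA⟩ := hq.2 s hs
    exact ⟨s, hs, A, hA, (hasFDerivAt_affineMap A x).congr_of_eventuallyEq
      (Filter.eventuallyEq_of_mem (mem_interior_iff_mem_nhds.1 hxs) hA)⟩
  have hLp : ∀ p, MemLp q p (volume.restrict Ω) := fun p => by
    obtain ⟨C, hC⟩ := hb.isCompact_closure.exists_bound_of_continuousOn hq.1
    exact MemLp.of_bound ((hq.1.mono subset_closure).aestronglyMeasurable hΩ.measurableSet) C
      ((ae_restrict_mem hΩ.measurableSet).mono fun x hx => hC x (subset_closure hx))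
  have hdiv : ∀ p, MemLp (fun x => diagSum (fderiv ℝ q x)) p (volume.restrict Ω) := fun p => by
    obtain ⟨C, hC⟩ : ∃ C : ℝ, ∀ᵐ x ∂volume.restrict Ω, ‖fderiv ℝ q x‖ ≤ C := by
      choose! A hA using hq.2
      obtain ⟨C, hC⟩ := (hK.finite_elements.image fun s => ‖affineDeriv (A s)‖).bddAbove
      refine ⟨C, ?_⟩
      filter_upwards [hK.ae_exists_mem_interior hΩ] with x hx
      obtain ⟨s, hs, hxs⟩ := hx
      rw [((hasFDerivAt_affineMap (A s) x).congr_of_eventuallyEq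
        (Filter.eventuallyEq_of_mem (mem_interior_iff_mem_nhds.1 hxs) (hA s hs))).fderiv]
      exact hC ⟨s, hs, rfl⟩
    refine MemLp.of_bound
      (continuous_diagSum.measurable.comp (measurable_fderiv ℝ q)).aestronglyMeasurable (d * C)
      (hC.mono fun x hx => ?_)
    exact (abs_diagSum_le _).trans (by gcongr)
  refine ⟨hLp p, hdiv p, isWeakDiv_of_locallyLipschitzOn hΩ hLip
    (memLp_one_iff_integrable.1 (hLp 1)) (memLp_one_iff_integrable.1 (hdiv 1)) ?_⟩
  filter_upwards [hae] with x hx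
  obtain ⟨s, -, A, -, hA⟩ := hx
  exact ⟨_, hA, by rw [hA.fderiv]⟩

/-- Error of affine interpolation of a `C²` field in the vertices of a shape regular simplex. -/
theorem norm_sub_interpolant_le {u : Space d → Space d} (hu : ContDiff ℝ 2 u) {M : ℝ≥0}
    (hM : LipschitzWith M (fderiv ℝ u)) {s : Finset (Space d)} {A : Space d →ᵃ[ℝ] Space d}
    (hA : ∀ v ∈ s, A v = u v) {κ D : ℝ} (hκ : 0 < κ) (hD : 0 < D)
    (hdiam : Metric.diam (convexHull ℝ (s : Set (Space d))) ≤ D) {c : Space d}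
    (hc : Metric.closedBall c (κ * D) ⊆ convexHull ℝ (s : Set (Space d))) {x : Space d}
    (hx : x ∈ convexHull ℝ (s : Set (Space d))) :
    ‖u x - A x‖ ≤ M * D ^ 2 ∧ ‖fderiv ℝ u x - affineDeriv A‖ ≤ 2 * M * D / κ := by
  set S := convexHull ℝ (s : Set (Space d)) with hS
  have hdist : ∀ y ∈ S, ∀ z ∈ S, dist y z ≤ D := fun y hy z hz =>
    (Metric.dist_le_diam_of_mem (s.finite_toSet.isCompact_convexHull ℝ).isBounded hy hz).trans hdiam
  have hrem : ∀ y ∈ S, ‖u y - u x - fderiv ℝ u x (y - x)‖ ≤ M * D ^ 2 := fun y hy => by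
    have h := (convex_convexHull ℝ (s : Set (Space d))).norm_image_sub_le_of_norm_fderiv_le'
      (𝕜 := ℝ) (f := u) (φ := fderiv ℝ u x) (C := M * D)
      (fun z _ => hu.differentiable two_ne_zero z) (fun z hz => by
        rw [← dist_eq_norm]
        exact (hM.dist_le_mul z x).trans (by gcongr; exact hdist z hz x hx)) hx hy
    refine h.trans ?_
    rw [pow_two, ← mul_assoc, ← dist_eq_norm]
    gcongr
    exact hdist y hy x hx
  -- B is A minus the first-order Taylor polynomial of u at x. At a vertex it equals the Taylor
  -- remainder, and by convexity of balls the bound M D² passes to the whole simplex. Its value at x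
  -- and its linear part are the two errors, up to sign.
  let B : Space d →ᵃ[ℝ] Space d := A - (fderiv ℝ u x).toLinearMap.toAffineMap
    - AffineMap.const ℝ _ (u x - fderiv ℝ u x x)
  have hB : ∀ y, B y = A y - fderiv ℝ u x y - (u x - fderiv ℝ u x x) := fun y => rfl
  have hBS : ∀ y ∈ S, ‖B y‖ ≤ M * D ^ 2 := by
    have hsub : S ⊆ B ⁻¹' Metric.closedBall 0 (M * D ^ 2) := by
      refine convexHull_min (fun v hv => ?_) ((convex_closedBall _ _).affine_preimage B)
      rw [Set.mem_preimage, mem_closedBall_zero_iff, hB, hA v hv]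
      have h := hrem v (subset_convexHull ℝ _ hv)
      rw [map_sub] at h
      rwa [show u v - fderiv ℝ u x v - (u x - fderiv ℝ u x x)
        = u v - u x - (fderiv ℝ u x v - fderiv ℝ u x x) by abel]
    exact fun y hy => mem_closedBall_zero_iff.1 (hsub hy)
  refine ⟨?_, ?_⟩
  · rw [norm_sub_rev]
    have h := hBS x hx
    rwa [hB, show A x - fderiv ℝ u x x - (u x - fderiv ℝ u x x) = A x - u x by abel] at h
  · rw [norm_sub_rev]
    refine ContinuousLinearMap.opNorm_le_of_unit_norm (by positivity) fun z hz => ?_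
    have hκD : 0 < κ * D := by positivity
    have h1 : c + (κ * D) • z ∈ S := hc (by
      rw [mem_closedBall_iff_norm, add_sub_cancel_left, norm_smul, hz,
        Real.norm_of_nonneg hκD.le, mul_one])
    have h2 : c ∈ S := hc (Metric.mem_closedBall_self hκD.le)
    -- The inscribed ball allows a step of length κD in every direction, over which B varies by at
    -- most 2 M D². Dividing gives 2MD/κ.
    have h3 : B (c + (κ * D) • z) - B c = (κ * D) • (affineDeriv A - fderiv ℝ u x) z := by
      have h4 : A (c + (κ * D) • z) - A c = (κ * D) • affineDeriv A z := by
        rw [affineMap_sub_eq, add_sub_cancel_left, map_smul]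
      rw [hB, hB, map_add (fderiv ℝ u x), map_smul (fderiv ℝ u x), sub_apply, smul_sub, ← h4]
      abel
    have h5 : κ * D * ‖(affineDeriv A - fderiv ℝ u x) z‖ ≤ 2 * (M * D ^ 2) := by
      rw [← Real.norm_of_nonneg hκD.le, ← norm_smul, ← h3, two_mul]
      exact (norm_sub_le _ _).trans (add_le_add (hBS _ h1) (hBS _ h2))
    rw [le_div_iff₀ hκ]
    nlinarith

end Interpolation

end DivFE

namespace DivFE

/-! ### Convergence of the interpolants and the final estimate -/

section Approximation

variable {d : ℕ}

/-- Nodal interpolants of smooth fields converge uniformly, together with their divergences. -/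
theorem IsRegularFamily.exists_interpolant_near (hd : d ≠ 0)
    {T : ℝ → Geometry.SimplicialComplex ℝ (Space d)} {Ω : Set (Space d)} (hΩ : IsOpen Ω)
    (hT : IsRegularFamily T Ω) {u : Space d → Space d} (hu : ContDiff ℝ 2 u)
    (huc : HasCompactSupport u) {δ : ℝ} (hδ : 0 < δ) :
    ∃ h₀ : ℝ, 0 < h₀ ∧ ∀ h : ℝ, 0 < h → h ≤ h₀ → ∃ q, MemS1 (T h) Ω q ∧
      ∀ᵐ x ∂volume.restrict Ω, ‖u x - q x‖ ≤ δ ∧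
        ‖diagSum (fderiv ℝ u x) - diagSum (fderiv ℝ q x)‖ ≤ δ := by
  obtain ⟨κ, hκ, hball⟩ := hT.shapeRegular
  obtain ⟨M, hM⟩ := (hu.fderiv_right (m := 1) (by norm_num)).lipschitzWith_of_hasCompactSupport
    (huc.fderiv ℝ) one_ne_zero
  obtain ⟨h₀, hh₀, h1, h2⟩ : ∃ h₀ : ℝ, 0 < h₀ ∧ M * h₀ ^ 2 ≤ δ ∧ d * (2 * M * h₀ / κ) ≤ δ := by
    have t1 : Filter.Tendsto (fun h : ℝ => M * h ^ 2) (nhdsWithin 0 (Set.Ioi 0)) (nhds 0) :=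
      (Continuous.tendsto' (by fun_prop) 0 0 (by simp)).mono_left nhdsWithin_le_nhds
    have t2 : Filter.Tendsto (fun h : ℝ => d * (2 * M * h / κ)) (nhdsWithin 0 (Set.Ioi 0))
        (nhds 0) :=
      (Continuous.tendsto' (by fun_prop) 0 0 (by simp)).mono_left nhdsWithin_le_nhds
    obtain ⟨h₀, ⟨ha, hb⟩, hc⟩ := (((t1.eventually_le_const hδ).and
      (t2.eventually_le_const hδ)).and self_mem_nhdsWithin).exists
    exact ⟨h₀, hc, ha, hb⟩
  refine ⟨h₀, hh₀, fun h hh hhh₀ => ?_⟩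
  have hK := hT.isTriangulation h hh
  obtain ⟨q, hq, hqu⟩ := hK.exists_interpolant u
  refine ⟨q, hq, ?_⟩
  filter_upwards [hK.ae_exists_mem_interior hΩ] with x hx
  obtain ⟨s, hs, hxs⟩ := hx
  obtain ⟨A, hA⟩ := hq.2 s hs
  have hxS := interior_subset hxs
  obtain ⟨c, hc⟩ := hball h hh s hs
  have hdiam := hT.diam_le h hh s hs
  set D := Metric.diam (convexHull ℝ (s : Set (Space d))) with hD
  -- As d ≠ 0, an element has at least two vertices.
  have hDpos : 0 < D := by
    have hcard : 1 < s.card := by rw [hs.2]; omega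
    obtain ⟨a, ha, b, hb, hab⟩ := Finset.one_lt_card.1 hcard
    exact (dist_pos.2 hab).trans_le (Metric.dist_le_diam_of_mem
      (s.finite_toSet.isCompact_convexHull ℝ).isBounded (subset_convexHull ℝ _ ha)
      (subset_convexHull ℝ _ hb))
  have hAu : ∀ v ∈ s, A v = u v := fun v hv => by
    rw [← hA (subset_convexHull ℝ _ hv), hqu s hs v hv]
  obtain ⟨e1, e2⟩ := norm_sub_interpolant_le hu hM hAu hκ hDpos le_rfl hc hxS
  have hDh : D ≤ h₀ := hdiam.trans hhh₀
  have hqd : HasFDerivAt q (affineDeriv A) x :=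
    (hasFDerivAt_affineMap A x).congr_of_eventuallyEq
      (Filter.eventuallyEq_of_mem (mem_interior_iff_mem_nhds.1 hxs) hA)
  rw [hA hxS, hqd.fderiv, ← diagSum_sub]
  refine ⟨e1.trans (le_trans (by gcongr) h1), (abs_diagSum_le _).trans ?_⟩
  calc d * ‖fderiv ℝ u x - affineDeriv A‖ ≤ d * (2 * M * D / κ) := by gcongr
    _ ≤ d * (2 * M * h₀ / κ) := by gcongr
    _ ≤ δ := h2

/-- The choice made in `weakDiv` is immaterial by a.e. uniqueness, so the norm can be computed with
explicit divergences. -/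
theorem wDivNorm_eq {β : ℝ≥0∞} (hβ : 1 ≤ β) {Ω : Set (Space d)} (hΩ : IsOpen Ω)
    {p : Space d → Space d} {f : Space d → ℝ} (hf : MemLp f β (volume.restrict Ω))
    (hpf : IsWeakDiv Ω p f) :
    wDivNorm β Ω p = eLpNorm p β (volume.restrict Ω) + eLpNorm f β (volume.restrict Ω) := by
  obtain ⟨h1, h2⟩ := weakDiv_spec ⟨f, hf, hpf⟩
  rw [wDivNorm, eLpNorm_congr_ae (IsWeakDiv.ae_eq hβ hΩ h1 hf h2 hpf)]

end Approximation

end DivFE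

theorem lemma2p1 {d : ℕ} (hd : d = 2 ∨ d = 3) {Ω : Set (DivFE.Space d)}
    (hΩ : DivFE.IsPolyhedralLipschitzDomain Ω)
    {T : ℝ → Geometry.SimplicialComplex ℝ (DivFE.Space d)} (hT : DivFE.IsRegularFamily T Ω)
    {β : ℝ≥0∞} (hβ : 1 ≤ β) (hβ' : β ≠ ∞)
    {p : DivFE.Space d → DivFE.Space d} (hp : DivFE.MemWDiv β Ω p)
    (ε : ℝ) (hε : 0 < ε) :
    ∃ h₀ : ℝ, 0 < h₀ ∧ ∀ h : ℝ, 0 < h → h ≤ h₀ →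
      ∃ q : DivFE.Space d → DivFE.Space d, DivFE.MemS1 (T h) Ω q ∧ DivFE.MemWDiv β Ω q ∧
        DivFE.wDivNorm β Ω (p - q) < ENNReal.ofReal ε := by
  have hΩo := hΩ.isOpen
  have hb := hΩ.isBounded
  have hfin : IsFiniteMeasure (volume.restrict Ω) := ⟨by
    rw [Measure.restrict_apply_univ]; exact hb.measure_lt_top⟩
  obtain ⟨hpL, f, hf, hpf⟩ := hp
  -- Four errors occur: smoothing and interpolation, each for the field and for its divergence.
  -- Fifths leave the final inequality strict.
  have hε5 : ENNReal.ofReal (ε / 5) ≠ 0 := by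
    rw [Ne, ENNReal.ofReal_eq_zero, not_le]
    positivity
  obtain ⟨u, hu, huc, hpu, hfu⟩ := DivFE.exists_contDiff_approx hβ hβ' hΩo hb
    hΩ.hasLipschitzBoundary hpL hf hpf hε5
  -- δ is the uniform tolerance whose L^β cost |Ω|^(1/β) δ is at most ε/5.
  obtain ⟨δ, hδ, hδε⟩ : ∃ δ : ℝ, 0 < δ ∧
      volume.restrict Ω Set.univ ^ β.toReal⁻¹ * ENNReal.ofReal δ ≤ ENNReal.ofReal (ε / 5) := by
    have hT : volume.restrict Ω Set.univ ^ β.toReal⁻¹ ≠ ∞ :=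
      ENNReal.rpow_ne_top_of_nonneg (by positivity) (measure_ne_top _ _)
    obtain ⟨a, ha, haε⟩ := ENNReal.exists_nnreal_pos_mul_lt hT hε5
    exact ⟨a, ha, by rw [mul_comm]; simpa using haε.le⟩
  obtain ⟨h₀, hh₀, hq⟩ := hT.exists_interpolant_near (by omega) hΩo hu huc hδ
  refine ⟨h₀, hh₀, fun h hh hhh₀ => ?_⟩
  obtain ⟨q, hqS, hqae⟩ := hq h hh hhh₀
  obtain ⟨hqL, hqd, hqw⟩ := hqS.isWeakDiv hΩo hb (hT.isTriangulation h hh) β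
  refine ⟨q, hqS, ⟨hqL, _, hqd, hqw⟩, ?_⟩
  have hw := hpf.sub (hpL.integrable hβ) (hqL.integrable hβ) (hf.integrable hβ)
    (hqd.integrable hβ) hqw
  have hum : AEStronglyMeasurable u (volume.restrict Ω) := hu.continuous.aestronglyMeasurable
  have hdm : AEStronglyMeasurable (fun x => DivFE.diagSum (fderiv ℝ u x)) (volume.restrict Ω) :=
    (DivFE.continuous_diagSum.comp (hu.continuous_fderiv two_ne_zero)).aestronglyMeasurable
  have huq : eLpNorm (u - q) β (volume.restrict Ω) ≤ ENNReal.ofReal (ε / 5) :=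
    (eLpNorm_le_of_ae_bound (hqae.mono fun x hx => hx.1)).trans hδε
  have hduq : eLpNorm ((fun x => DivFE.diagSum (fderiv ℝ u x)) - fun x => DivFE.diagSum (fderiv ℝ q x)) β
      (volume.restrict Ω) ≤ ENNReal.ofReal (ε / 5) :=
    (eLpNorm_le_of_ae_bound (hqae.mono fun x hx => hx.2)).trans hδε
  have h1 : eLpNorm (p - q) β (volume.restrict Ω)
      ≤ ENNReal.ofReal (ε / 5) + ENNReal.ofReal (ε / 5) := by
    rw [← sub_add_sub_cancel p u q]
    exact (eLpNorm_add_le (hpL.1.sub hum) (hum.sub hqL.1) hβ).trans (add_le_add hpu huq)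
  have h2 : eLpNorm (f - fun x => DivFE.diagSum (fderiv ℝ q x)) β (volume.restrict Ω)
      ≤ ENNReal.ofReal (ε / 5) + ENNReal.ofReal (ε / 5) := by
    rw [← sub_add_sub_cancel f (fun x => DivFE.diagSum (fderiv ℝ u x))]
    exact (eLpNorm_add_le (hf.1.sub hdm) (hdm.sub hqd.1) hβ).trans (add_le_add hfu hduq)
  rw [DivFE.wDivNorm_eq hβ hΩo (hf.sub hqd) hw]
  refine (add_le_add h1 h2).trans_lt ?_
  rw [← ENNReal.ofReal_add (by positivity) (by positivity),
    ← ENNReal.ofReal_add (by positivity) (by positivity)]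
  exact (ENNReal.ofReal_lt_ofReal_iff hε).2 (by linarith)
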